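/- Let $N,k\ge 1$, $Q=(-1/2,1/2)^N$, and let $\mathbb M^{N^m}$ be the space of real tensors of order $m$ with the Euclidean norm. All functions live on $Q$; $\mathcal M_b(Q;\mathbb M^{N^m})=C_0(Q;\mathbb M^{N^m})^*$ is the space of bounded Radon measures, and $|T|_{\mathcal M_b}$ denotes the total variation of a distribution $T$ on $Q$ if $T\in\mathcal M_b$, and $+\infty$ otherwise. *Operators.* For $l\ge1$ consider the operators $\mathscr B v=\sum_{i=1}^N B^i\,\partial_i v$ (distributional derivatives) from $\mathbb M^{N^l}$-valued to $\mathbb M^{N^{l+1}}$-valued distributions, where the constant coefficients $B^i$ are linear maps $\mathbb M^{N^l}\to\mathbb M^{N^{l+1}}$; put $\|\mathscr B\|_{\ell^\infty}=\sum_i\|B^i\|$ with Euclidean norms of the coefficient tensors. Let $$BV_{\mathscr B}(Q;\mathbb M^{N^l})=\{v\in L^1(Q;\mathbb M^{N^l}):\mathscr B v\in\mathcal M_b(Q;\mathbb M^{N^{l+1}})\},\qquad \|v\|_{BV_{\mathscr B}}=\|v\|_{L^1}+|\mathscr Bv|_{\mathcal M_b}.$$ We call $\mathscr B$ admissible if (1)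 $BV_{\mathscr B}$ is a Banach space; (2) for every $v\in BV_{\mathscr B}$ there are $v_n\in C^\infty(\overline Q)$ with $v_n\to v$ in $L^1$ and $|\mathscr Bv_n|_{\mathcal M_b}\to|\mathscr Bv|_{\mathcal M_b}$; (3) the injection $BV_{\mathscr B}\to L^1$ is compact. $\Pi_l$ is the set of admissible $\mathscr B$ whose null-space $\{v\in L^1:\mathscr Bv=0\}$ is finite dimensional, and $\Pi^k=\Pi_1\times\cdots\times\Pi_k$. A collection $S$ of operators has property (C) if, for all admissible $\mathscr B_n\in S$ and $v_n\in BV_{\mathscr B_n}$ with $\sup_n(\|\mathscr B_n\|_{\ell^\infty}+\|v_n\|_{BV_{\mathscr B_n}})<\infty$, there are an operator $\mathscr B$ and $v\in BV_{\mathscr B}$ such that, up to a subsequence, $v_n\to v$ in $L^1$ and $\mathscr B_nv_n\rightharpoonup^*\mathscr Bv$ in $\mathcal M_b$. *Functionals.* For a tuple $\mathscr B[k]=(\mathscr B^0,\dots,\mathscr B^{k-1})$ of such operators, $\mathscr B^l$ acting on $\mathbb M^{N^{l+1}}$-valued distributions, for $\alpha=(\alpha_0,\dots,\alpha_k)\in(0,\infty)^{k+1}$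 and $u\in L^1(Q)$, let $$PGV^{k+1}_{\alpha,\mathscr B[k]}(u)=\inf\Big\{\alpha_0|Du-v_0|_{\mathcal M_b}+\sum_{l=1}^{k-1}\alpha_l|v_l-\mathscr B^{l-1}v_{l-1}|_{\mathcal M_b}+\alpha_k|\mathscr B^{k-1}v_{k-1}|_{\mathcal M_b}:\ v_l\in BV_{\mathscr B^l}(Q;\mathbb M^{N^{l+1}})\Big\}.$$ Fix $u_\eta\in L^2(Q)$ and let $\mathcal I_{\alpha,\mathscr B[k]}:L^1(Q)\to[0,\infty]$ be $\|u-u_\eta\|_{L^2(Q)}^2+PGV^{k+1}_{\alpha,\mathscr B[k]}(u)$ if $u\in BV(Q)$, and $+\infty$ otherwise. **Theorem 4.2.** Let $\mathscr B_n[k]=(\mathscr B_n^0,\dots,\mathscr B_n^{k-1})\in\Pi^k$ be such that, for each $l$, the collection $\{\mathscr B_n^l:n\in\mathbb N\}$ has property (C). Let $\mathscr B[k]$ be a tuple of operators as above with $\|\mathscr B_n^l-\mathscr B^l\|_{\ell^\infty}\to0$ for each $l$, and let $\alpha_n\to\alpha$ with $\alpha_n,\alpha\in(0,\infty)^{k+1}$.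 Then: - (Compactness) If $u_n\in BV(Q)$ and $\sup_n\mathcal I_{\alpha_n,\mathscr B_n[k]}(u_n)<\infty$, then there is $u\in BV(Q)$ such that, up to a subsequence, $u_n\rightharpoonup^*u$ in $BV(Q)$, i.e. $u_n\to u$ in $L^1(Q)$ and $Du_n\rightharpoonup^*Du$ in $\mathcal M_b(Q;\mathbb R^N)$. - ($\Gamma$-convergence) $\mathcal I_{\alpha_n,\mathscr B_n[k]}$ $\Gamma$-converges to $\mathcal I_{\alpha,\mathscr B[k]}$ in the $L^1(Q)$ topology: for every $u\in L^1(Q)$, (liminf) $u_n\to u$ in $L^1(Q)$ implies $\mathcal I_{\alpha,\mathscr B[k]}(u)\le\liminf_n\mathcal I_{\alpha_n,\mathscr B_n[k]}(u_n)$, and (recovery) there are $u_n\to u$ in $L^1(Q)$ with $\limsup_n\mathcal I_{\alpha_n,\mathscr B_n[k]}(u_n)\le\mathcal I_{\alpha,\mathscr B[k]}(u)$. If $u\in BV(Q)$, the recovery sequence can be chosen in $BV(Q)$. -/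

import Mathlib

open MeasureTheory Filter Topology Set
open scoped ENNReal NNReal ContDiff ZeroAtInfty Distributions

noncomputable section

namespace PGV

/-! ### The cube, tensors, function spaces -/

/-- The open unit cube `Q = (-1/2, 1/2)^N` in `ℝ^N`. -/
def cube (N : ℕ) : TopologicalSpace.Opens (EuclideanSpace ℝ (Fin N)) where
  carrier := {x | ∀ i, x i ∈ Ioo (-(1 / 2) : ℝ) (1 / 2)}
  is_open' := by
    simp only [ofPred_forall]
    refine isOpen_iInter_of_finite fun i => ?_
    exact isOpen_Ioo.preimage (by fun_prop)

/-- Lebesgue measure on `Q`. -/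
abbrev cubeVol (N : ℕ) : Measure (cube N) := (volume : Measure _).comap Subtype.val

/-- The space `𝕄^{N^m}` of real tensors of order `m`, with the Euclidean norm. -/
abbrev Tensor (N m : ℕ) : Type := EuclideanSpace ℝ (Fin m → Fin N)

/-- `L¹(Q; 𝕄^{N^m})`, with respect to Lebesgue measure on `Q`. -/
abbrev L1 (N m : ℕ) : Type := Lp (Tensor N m) 1 (cubeVol N)

/-- The real space `L¹(Q)`. -/
abbrev L1R (N : ℕ) : Type := Lp ℝ 1 (cubeVol N)

/-- The real space `L²(Q)`. -/
abbrev L2R (N : ℕ) : Type := Lp ℝ 2 (cubeVol N)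

/-- The space `C_c^∞(Q; 𝕄^{N^m})` of test functions. -/
abbrev Test (N m : ℕ) : Type := TestFunction (cube N) (Tensor N m) ⊤

/-- The space `C₀(Q; 𝕄^{N^m})` of continuous functions on `Q` that vanish at `∂Q`, with the sup
norm (Mathlib's space, under a name of its own to have a single path to its normed structure). -/
def C0 (N m : ℕ) : Type := C₀(cube N, Tensor N m)

instance (N m : ℕ) : NormedAddCommGroup (C0 N m) :=
  inferInstanceAs (NormedAddCommGroup C₀(cube N, Tensor N m))

instance (N m : ℕ) : NormedSpace ℝ (C0 N m) :=
  inferInstanceAs (NormedSpace ℝ C₀(cube N, Tensor N m))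

instance (N m : ℕ) : FunLike (C0 N m) (cube N) (Tensor N m) :=
  inferInstanceAs (FunLike C₀(cube N, Tensor N m) (cube N) (Tensor N m))

/-- The space `𝓜_b(Q; 𝕄^{N^m})` of bounded tensor-valued Radon measures on `Q`, as the dual of
`C₀(Q; 𝕄^{N^m})`: a measure `μ` is the functional `ψ ↦ ∫ ψ · dμ`, the dual norm `‖μ‖` is the total
variation `|μ|(Q)`, and weak* convergence is convergence against every `ψ ∈ C₀`. -/
abbrev Mb (N m : ℕ) : Type := StrongDual ℝ (C0 N m)

/-- A test function, restricted to `Q` and regarded as an element of `C₀(Q)`. -/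
def Test.toC0 {N m : ℕ} (φ : Test N m) : C0 N m where
  toFun := fun x : cube N => φ x
  continuous_toFun := φ.contDiff.continuous.comp continuous_subtype_val
  zero_at_infty' := by
    have h : HasCompactSupport (fun x : cube N => φ x) := by
      refine HasCompactSupport.of_support_subset_isCompact
        (K := (Subtype.val : cube N → _) ⁻¹' tsupport φ) ?_ ?_
      · refine Topology.IsInducing.subtypeVal.isCompact_preimage' φ.hasCompactSupport ?_
        intro x hx
        exact ⟨⟨x, φ.tsupport_subset hx⟩, rfl⟩
      · intro x hx
        exact subset_tsupport _ hx
    exact h.is_zero_at_infty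

/-! ### First order operators and the distributions they produce

A distribution with values in `𝕄^{N^m}` is recorded by its values on the tensor-valued test
functions. -/

/-- A first order operator `𝓑 = ∑ i, B^i ∂_i` with constant coefficients, from `𝕄^{N^l}`-valued to
`𝕄^{N^{l+1}}`-valued distributions. The coefficient `B^i` is a linear map
`𝕄^{N^l} → 𝕄^{N^{l+1}}`, i.e. a tensor with entries `B^i_{J K}`, where the multi-index `J` has
length `l + 1` and `K` has length `l`. -/
abbrev DiffOp (N l : ℕ) : Type :=
  Fin N → EuclideanSpace ℝ ((Fin (l + 1) → Fin N) × (Fin l → Fin N))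

/-- `‖𝓑‖_{ℓ^∞} = ∑ i, ‖B^i‖`, with Euclidean norms of the coefficients. -/
def opNorm {N l : ℕ} (B : DiffOp N l) : ℝ := ∑ i, ‖B i‖

/-- The partial derivative `∂_i φ` at the point `x`. -/
def pderiv {N m : ℕ} (i : Fin N) (φ : Test N m) (x : EuclideanSpace ℝ (Fin N)) : Tensor N m :=
  fderiv ℝ φ x (EuclideanSpace.single i 1)

/-- The distribution `w` for `w ∈ L¹`: `φ ↦ ∫_Q w · φ`. -/
def toDist {N m : ℕ} (w : L1 N m) (φ : Test N m) : ℝ :=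
  ∫ x, ∑ J, w x J * φ x J ∂cubeVol N

/-- The distribution `𝓑 v`, `(𝓑 v)_J = ∑ i, ∑ K, B^i_{J K} ∂_i v_K`, for `v ∈ L¹`:
`φ ↦ - ∫_Q ∑ i, ∑ J, ∑ K, B^i_{J K} v_K ∂_i φ_J`. -/
def distOp {N l : ℕ} (B : DiffOp N l) (v : L1 N l) (φ : Test N (l + 1)) : ℝ :=
  - ∫ x, ∑ i, ∑ J, ∑ K, B i (J, K) * v x K * pderiv i φ x J ∂cubeVol N

/-- The distributional gradient `Du` of `u ∈ L¹(Q)`: `φ ↦ - ∫_Q u ∑ i, ∂_i φ_i`. -/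
def distGrad {N : ℕ} (u : L1R N) (φ : Test N 1) : ℝ :=
  - ∫ x, u x * ∑ i, pderiv i φ x (fun _ => i) ∂cubeVol N

/-- The distribution `T` is (given by) the bounded measure `μ`. -/
def IsMeas {N m : ℕ} (T : Test N m → ℝ) (μ : Mb N m) : Prop :=
  ∀ φ : Test N m, μ φ.toC0 = T φ

/-- `|T|_{𝓜_b(Q)}`: the total variation of the distribution `T` if `T` is a bounded measure (which
is then unique), and `∞` otherwise. -/
def mass {N m : ℕ} (T : Test N m → ℝ) : ℝ≥0∞ :=
  ⨅ (μ : Mb N m) (_ : IsMeas T μ), ENNReal.ofReal ‖μ‖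

/-- The distributions `T n` and `T` are bounded measures and `T n ⇀* T` in `𝓜_b(Q)`. -/
def MeasWeakStar {N m : ℕ} (T : ℕ → Test N m → ℝ) (T' : Test N m → ℝ) : Prop :=
  ∃ (μ : ℕ → Mb N m) (μ' : Mb N m), (∀ n, IsMeas (T n) (μ n)) ∧ IsMeas T' μ' ∧
    ∀ ψ : C0 N m, Tendsto (fun n => μ n ψ) atTop (𝓝 (μ' ψ))

/-! ### `BV` and `BV_𝓑` -/

/-- `BV(Q)`. -/
def BV (N : ℕ) : Set (L1R N) := {u | ∃ μ, IsMeas (distGrad u) μ}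

/-- Weak* convergence in `BV(Q)`: `u n → u` in `L¹(Q)` and `D(u n) ⇀* Du` in `𝓜_b(Q; ℝ^N)`. -/
def BVWeakStar {N : ℕ} (u : ℕ → L1R N) (u' : L1R N) : Prop :=
  Tendsto u atTop (𝓝 u') ∧ MeasWeakStar (fun n => distGrad (u n)) (distGrad u')

/-- `BV_𝓑(Q; 𝕄^{N^l}) = {v ∈ L¹ : 𝓑 v ∈ 𝓜_b}`. -/
def BVOp {N l : ℕ} (B : DiffOp N l) : Set (L1 N l) := {v | ∃ μ, IsMeas (distOp B v) μ}

/-- `‖v‖_{BV_𝓑} = ‖v‖_{L¹} + |𝓑 v|_{𝓜_b}`. -/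
def bvNorm {N l : ℕ} (B : DiffOp N l) (v : L1 N l) : ℝ≥0∞ := ‖v‖ₑ + mass (distOp B v)

theorem integrable_distOp {N l : ℕ} (B : DiffOp N l) (v : L1 N l) (φ : Test N (l + 1)) :
    Integrable (fun x : cube N => ∑ i, ∑ J, ∑ K, B i (J, K) * v x K * pderiv i φ x J)
      (cubeVol N) := by
  refine integrable_finsetSum _ fun i _ => integrable_finsetSum _ fun J _ =>
    integrable_finsetSum _ fun K _ => ?_
  have hv : Integrable (fun x : cube N => v x K) (cubeVol N) :=
    (EuclideanSpace.proj (𝕜 := ℝ) K).integrable_comp (L1.integrable_coeFn v)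
  have hc : Continuous (fun x => pderiv i φ x J) := by
    have h1 : Continuous (fderiv ℝ φ) := φ.contDiff.continuous_fderiv (by simp)
    unfold pderiv
    fun_prop
  have hs : HasCompactSupport (fun x => pderiv i φ x J) := by
    have h1 : HasCompactSupport (fderiv ℝ φ) := φ.hasCompactSupport.fderiv ℝ
    exact h1.comp_left
      (g := fun L : EuclideanSpace ℝ (Fin N) →L[ℝ] Tensor N (l + 1) =>
        L (EuclideanSpace.single i 1) J) (by simp)
  obtain ⟨C, hC⟩ := hc.bounded_above_of_compact_support hs
  exact (hv.const_mul (B i (J, K))).mul_bdd (c := C)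
    (hc.comp continuous_subtype_val).aestronglyMeasurable
    (Eventually.of_forall fun x => hC x)

/-- The null-space `𝓝(𝓑) = {v ∈ L¹ : 𝓑 v = 0}`. -/
def nullSpace {N l : ℕ} (B : DiffOp N l) : Submodule ℝ (L1 N l) where
  carrier := {v | ∀ φ, distOp B v φ = 0}
  zero_mem' := by
    intro φ
    have h : (fun x : cube N => ∑ i, ∑ J, ∑ K,
        B i (J, K) * (0 : L1 N l) x K * pderiv i φ x J) =ᵐ[cubeVol N] fun _ => (0 : ℝ) := by
      filter_upwards [Lp.coeFn_zero (Tensor N l) 1 (cubeVol N)] with x hx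
      rw [hx]
      simp
    rw [distOp, integral_congr_ae h, integral_zero, neg_zero]
  add_mem' := by
    intro a b ha hb φ
    have h : (fun x : cube N => ∑ i, ∑ J, ∑ K, B i (J, K) * (a + b) x K * pderiv i φ x J)
        =ᵐ[cubeVol N] fun x => (∑ i, ∑ J, ∑ K, B i (J, K) * a x K * pderiv i φ x J)
          + ∑ i, ∑ J, ∑ K, B i (J, K) * b x K * pderiv i φ x J := by
      filter_upwards [Lp.coeFn_add a b] with x hx
      simp only [hx, Pi.add_apply, PiLp.add_apply, mul_add, add_mul, Finset.sum_add_distrib]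
    have ha' := ha φ
    have hb' := hb φ
    simp only [distOp, neg_eq_zero] at ha' hb' ⊢
    rw [integral_congr_ae h, integral_add (integrable_distOp B a φ) (integrable_distOp B b φ),
      ha', hb', add_zero]
  smul_mem' := by
    intro c a ha φ
    have h : (fun x : cube N => ∑ i, ∑ J, ∑ K, B i (J, K) * (c • a) x K * pderiv i φ x J)
        =ᵐ[cubeVol N] fun x => c * ∑ i, ∑ J, ∑ K, B i (J, K) * a x K * pderiv i φ x J := by
      filter_upwards [Lp.coeFn_smul c a] with x hx
      simp only [hx, Pi.smul_apply, PiLp.smul_apply, smul_eq_mul, Finset.mul_sum]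
      refine Finset.sum_congr rfl fun i _ => Finset.sum_congr rfl fun J _ =>
        Finset.sum_congr rfl fun K _ => by ring
    have ha' := ha φ
    simp only [distOp, neg_eq_zero] at ha' ⊢
    rw [integral_congr_ae h, integral_const_mul, ha', mul_zero]

/-! ### Admissible operators -/

/-- The basic requirements on an operator `𝓑`. -/
structure Admissible {N l : ℕ} (B : DiffOp N l) : Prop where
  /-- `BV_𝓑` is complete for its norm. -/
  banach : ∀ v : ℕ → L1 N l, (∀ n, v n ∈ BVOp B) →
    (∀ ε : ℝ≥0∞, 0 < ε → ∃ n₀, ∀ m ≥ n₀, ∀ n ≥ n₀, bvNorm B (v m - v n) < ε) →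
    ∃ v' ∈ BVOp B, Tendsto (fun n => bvNorm B (v n - v')) atTop (𝓝 0)
  /-- `C^∞(Q̄)` is dense in `BV_𝓑` in the strict topology. -/
  dense : ∀ v ∈ BVOp B, ∃ (f : ℕ → EuclideanSpace ℝ (Fin N) → Tensor N l) (w : ℕ → L1 N l),
    (∀ n, ContDiff ℝ ∞ (f n)) ∧ (∀ n, w n =ᵐ[cubeVol N] fun x : cube N => f n x) ∧
    Tendsto w atTop (𝓝 v) ∧
    Tendsto (fun n => mass (distOp B (w n))) atTop (𝓝 (mass (distOp B v)))
  /-- The injection of `BV_𝓑` into `L¹` is compact. -/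
  compact : ∀ M : ℝ≥0, IsCompact (closure {v : L1 N l | v ∈ BVOp B ∧ bvNorm B v ≤ M})

/-- The class `Π_l` of admissible operators with finite dimensional null-space. -/
def PiClass (N l : ℕ) : Set (DiffOp N l) :=
  {B | Admissible B ∧ FiniteDimensional ℝ (nullSpace B)}

/-- The compactness and closure property of a collection `S` of operators: from any operators
`B n ∈ S` and any functions `v n` with `‖B n‖_{ℓ^∞} + ‖v n‖_{BV_{B n}}` bounded, one can extract
a subsequence along which `v n → v` in `L¹` and `(B n)(v n) ⇀* B' v` in `𝓜_b`, for some operator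
`B'` and some `v ∈ BV_{B'}`. -/
def CompactClosed {N l : ℕ} (S : Set (DiffOp N l)) : Prop :=
  ∀ (B : ℕ → DiffOp N l) (v : ℕ → L1 N l), (∀ n, B n ∈ S) → (∀ n, Admissible (B n)) →
    (∀ n, v n ∈ BVOp (B n)) →
    (⨆ n, (ENNReal.ofReal (opNorm (B n)) + bvNorm (B n) (v n))) < ⊤ →
    ∃ (B' : DiffOp N l) (v' : L1 N l) (s : ℕ → ℕ), v' ∈ BVOp B' ∧ StrictMono s ∧
      Tendsto (fun j => v (s j)) atTop (𝓝 v') ∧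
      MeasWeakStar (fun j => distOp (B (s j)) (v (s j))) (distOp B' v')

/-! ### The seminorms and the functionals -/

/-- The tuple `(v_0, …, v_{k-1})`, continued by `v_l = 0` for `l ≥ k`. -/
def extend {N k : ℕ} (v : (l : Fin k) → L1 N (l + 1)) (l : ℕ) : L1 N (l + 1) :=
  if h : l < k then v ⟨l, h⟩ else 0

/-- `PGV^{k+1}_{α, 𝓑[k]}(u)`, where `𝓑[k] = (𝓑^0, …, 𝓑^{k-1})` and `α = (α_0, …, α_k)`: the infimum,
over `v_l ∈ BV_{𝓑^l}(Q; 𝕄^{N^{l+1}})`, `l = 0, …, k-1`, of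
`α_0 |Du - v_0| + ∑_{l=0}^{k-1} α_{l+1} |v_{l+1} - 𝓑^l v_l|`, where `v_k = 0`. -/
def pgv {N k : ℕ} (α : Fin (k + 1) → ℝ) (B : (l : Fin k) → DiffOp N (l + 1)) (u : L1R N) :
    ℝ≥0∞ :=
  ⨅ (v : (l : Fin k) → L1 N (l + 1)) (_ : ∀ l, v l ∈ BVOp (B l)),
    ENNReal.ofReal (α 0) * mass (fun φ => distGrad u φ - toDist (extend v 0) φ) +
    ∑ l : Fin k, ENNReal.ofReal (α l.succ) *
      mass (fun φ => toDist (extend v (l + 1)) φ - distOp (B l) (v l) φ)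

open Classical in
/-- The functional `𝓘^{k+1}_{α, 𝓑[k]} : L¹(Q) → [0, ∞]`. -/
def energy {N k : ℕ} (uη : L2R N) (α : Fin (k + 1) → ℝ) (B : (l : Fin k) → DiffOp N (l + 1))
    (u : L1R N) : ℝ≥0∞ :=
  if u ∈ BV N then eLpNorm (fun x => u x - uη x) 2 (cubeVol N) ^ 2 + pgv α B u else ⊤

/-- Sequential `Γ`-convergence of functionals (on a metric space such as `L¹(Q)` this is
`Γ`-convergence). -/
def GammaConverges {X : Type*} [TopologicalSpace X] (F : ℕ → X → ℝ≥0∞) (F' : X → ℝ≥0∞) : Prop :=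
  (∀ (x : X) (y : ℕ → X), Tendsto y atTop (𝓝 x) →
    F' x ≤ liminf (fun n => F n (y n)) atTop) ∧
  (∀ x : X, ∃ y : ℕ → X, Tendsto y atTop (𝓝 x) ∧
    limsup (fun n => F n (y n)) atTop ≤ F' x)

end PGV

end

/-! Everything is done by testing. By Hahn–Banach, a linear functional `T` on test functions has
`mass T ≤ C` exactly when `|T φ| ≤ C ‖φ‖` for all `φ`. Hence the total variation is lower
semicontinuous under convergence of distributions. Moreover `Du`, `v` and `𝓑 v` depend continuously,
as distributions, on `u` and `v` in `L¹` and on the coefficients of `𝓑`, because the derivatives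
fall on the test function.

The a priori bound is `ConvergentFamily.exists_norm_le`: if `u_n` is bounded in `L¹` and the
residuals `Du_n - v_0`, `v_{l+1} - 𝓑_n^l v_l` are bounded measures uniformly in `n`, then the fields
are bounded in `L¹`. Otherwise divide by their total norm. The scaled functions and residuals tend
to `0`, property (C) gives a strong `L¹` limit `w`, and in the limit `w_0 = 0` and `w_{l+1} = 𝓑^l
w_l`. So `w = 0`, although the total norm is `1` along the sequence. This bounds `Du_n`, and
compactness in `BV(Q)` follows from the compact embedding of one `BV_𝓑`, applied to the fields `u_n
e_K`. The liminf inequality follows by extracting limits of almost optimal fields and using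
semicontinuity term by term.

The recovery sequence is constant. The obstacle is that `𝓑_n v` need not be a measure when `𝓑 v` is
one. The fields are therefore replaced by `v_ε = ρ_ε ⋆ v((1 + ε)⁻¹ ·)`. The transpose of this
regularization maps test functions on `Q` to test functions on `Q` and multiplies sup norms by at
most `(1 + ε)^N`. So the residuals for `𝓑` deteriorate by a factor tending to `1` and an error
tending to `0`, while `(𝓑_n - 𝓑) v_ε` has mass at most a constant depending on `ε` times the
weighted difference of the coefficients. Letting `n → ∞` and then `ε → 0` gives the limsup
inequality (`limsup_energy_le`). -/

noncomputable section

namespace PGV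

section

variable {N m : ℕ}

/-! ### The norm of `C₀` and test functions -/

theorem C0.norm_apply_le (ψ : C0 N m) (x : cube N) : ‖ψ x‖ ≤ ‖ψ‖ :=
  (ZeroAtInftyContinuousMap.toBCF (α := cube N) (β := Tensor N m) ψ).norm_coe_le_norm x

theorem C0.norm_le {ψ : C0 N m} {C : ℝ} (hC : 0 ≤ C) (h : ∀ x, ‖ψ x‖ ≤ C) : ‖ψ‖ ≤ C :=
  (BoundedContinuousFunction.norm_le
    (f := ZeroAtInftyContinuousMap.toBCF (α := cube N) (β := Tensor N m) ψ) hC).2 h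

@[simp]
theorem Test.toC0_apply (φ : Test N m) (x : cube N) : φ.toC0 x = φ x := rfl

theorem Test.eq_zero_of_notMem (φ : Test N m) {x : EuclideanSpace ℝ (Fin N)}
    (hx : x ∉ cube N) : φ x = 0 :=
  image_eq_zero_of_notMem_tsupport fun h => hx (φ.tsupport_subset h)

theorem Test.norm_apply_le (φ : Test N m) (x : EuclideanSpace ℝ (Fin N)) :
    ‖φ x‖ ≤ ‖φ.toC0‖ := by
  by_cases hx : x ∈ cube N
  · exact φ.toC0.norm_apply_le ⟨x, hx⟩
  · rw [φ.eq_zero_of_notMem hx, norm_zero]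
    exact norm_nonneg _

/-- Restriction of test functions to the cube, as a linear map into `C₀`. -/
def Test.toC0Linear (N m : ℕ) : Test N m →ₗ[ℝ] C0 N m where
  toFun := Test.toC0
  map_add' _ _ := rfl
  map_smul' _ _ := rfl

theorem Test.toC0Linear_injective : Function.Injective (Test.toC0Linear N m) := by
  rw [injective_iff_map_eq_zero]
  intro φ hφ
  ext1 x
  have h : ‖φ x‖ ≤ ‖φ.toC0‖ := φ.norm_apply_le x
  rw [show φ.toC0 = 0 from hφ, norm_zero] at h
  exact norm_le_zero_iff.1 h

/-! ### Total variation of linear functionals on test functions -/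

theorem IsMeas.exists_of_mass_lt {T : Test N m → ℝ} {C : ℝ≥0∞} (h : mass T < C) :
    ∃ μ, IsMeas T μ ∧ ENNReal.ofReal ‖μ‖ < C := by
  simpa only [mass, iInf_lt_iff, exists_prop] using h

theorem IsMeas.mass_le {T : Test N m → ℝ} {μ : Mb N m} (h : IsMeas T μ) :
    mass T ≤ ENNReal.ofReal ‖μ‖ := iInf₂_le μ h

theorem IsMeas.mass_lt_top {T : Test N m → ℝ} {μ : Mb N m} (h : IsMeas T μ) : mass T < ⊤ :=
  h.mass_le.trans_lt ENNReal.ofReal_lt_top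

theorem mass_lt_top_iff {T : Test N m → ℝ} : mass T < ⊤ ↔ ∃ μ, IsMeas T μ :=
  ⟨fun h => (IsMeas.exists_of_mass_lt h).imp fun _ h => h.1, fun ⟨_, h⟩ => h.mass_lt_top⟩

/-- Hahn–Banach: `T` is a bounded functional on the image of the test functions in `C₀`, and a
norm-preserving extension is a competitor in the infimum defining `mass`. With `enorm_le_mass_mul`,
this makes `mass T` the best constant in the bound on `T`, so that later estimates only involve test
functions. -/
theorem mass_le_of_forall_enorm_le {T : Test N m → ℝ} (hT : IsLinearMap ℝ T) {C : ℝ≥0∞}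
    (h : ∀ φ : Test N m, ‖T φ‖ₑ ≤ C * ‖φ.toC0‖ₑ) : mass T ≤ C := by
  rcases eq_or_ne C ⊤ with rfl | hC
  · exact le_top
  lift C to ℝ≥0 using hC
  have hbd : ∀ φ : Test N m, ‖T φ‖ ≤ C * ‖φ.toC0‖ := fun φ => by
    have := h φ
    rw [enorm_eq_nnnorm, enorm_eq_nnnorm, ← ENNReal.coe_mul, ENNReal.coe_le_coe] at this
    exact_mod_cast this
  let e := LinearEquiv.ofInjective (Test.toC0Linear N m) Test.toC0Linear_injective
  let F : LinearMap.range (Test.toC0Linear N m) →ₗ[ℝ] ℝ := hT.mk' T ∘ₗ e.symm.toLinearMap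
  have hF : ∀ y, ‖F y‖ ≤ C * ‖y‖ := fun y => by
    obtain ⟨φ, rfl⟩ := e.surjective y
    simpa [F] using! hbd φ
  obtain ⟨μ, hμ, hnorm⟩ := exists_extension_norm_eq _ (F.mkContinuous C hF)
  have hmeas : IsMeas T μ := fun φ => by
    calc μ φ.toC0 = F (e φ) := hμ (e φ)
      _ = T φ := by simp [F]
  refine hmeas.mass_le.trans (ENNReal.ofReal_le_of_le_toReal ?_)
  rw [hnorm, ENNReal.coe_toReal]
  exact LinearMap.mkContinuous_norm_le _ C.2 _

theorem enorm_le_mass_mul {T : Test N m → ℝ} (hT : IsLinearMap ℝ T) (φ : Test N m) :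
    ‖T φ‖ₑ ≤ mass T * ‖φ.toC0‖ₑ := by
  -- When `mass T = ⊤` and `φ.toC0 = 0` the right side is `⊤ * 0 = 0`, so here linearity and
  -- injectivity are needed.
  rcases eq_or_ne φ.toC0 0 with h | h
  · have : φ = 0 := Test.toC0Linear_injective (h.trans (map_zero (Test.toC0Linear N m)).symm)
    rw [this, hT.map_zero, enorm_zero]
    exact zero_le
  have h0 : ‖φ.toC0‖ₑ ≠ 0 := by simpa using h
  rw [← ENNReal.div_le_iff h0 (by simp)]
  refine le_iInf₂ fun μ hμ => ?_
  rw [ENNReal.div_le_iff h0 (by simp), ← hμ φ, ofReal_norm]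
  exact μ.le_opENorm _

theorem mass_add_le {S T : Test N m → ℝ} (hS : IsLinearMap ℝ S) (hT : IsLinearMap ℝ T) :
    mass (fun φ => S φ + T φ) ≤ mass S + mass T := by
  refine mass_le_of_forall_enorm_le (hS.mk' S + hT.mk' T).isLinear fun φ => ?_
  rw [add_mul]
  exact (enorm_add_le _ _).trans (add_le_add (enorm_le_mass_mul hS φ) (enorm_le_mass_mul hT φ))

theorem mass_sub_le {S T : Test N m → ℝ} (hS : IsLinearMap ℝ S) (hT : IsLinearMap ℝ T) :
    mass (fun φ => S φ - T φ) ≤ mass S + mass T := by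
  refine mass_le_of_forall_enorm_le (hS.mk' S - hT.mk' T).isLinear fun φ => ?_
  rw [add_mul]
  exact (enorm_sub_le).trans (add_le_add (enorm_le_mass_mul hS φ) (enorm_le_mass_mul hT φ))

theorem mass_le_of_sub {S T : Test N m → ℝ} (hS : IsLinearMap ℝ S) (hT : IsLinearMap ℝ T) :
    mass S ≤ mass (fun φ => S φ - T φ) + mass T := by
  calc mass S = mass (fun φ => (S φ - T φ) + T φ) := by simp only [sub_add_cancel]
    _ ≤ _ := mass_add_le (hS.mk' S - hT.mk' T).isLinear hT

theorem mass_le_of_sub' {S T : Test N m → ℝ} (hS : IsLinearMap ℝ S) (hT : IsLinearMap ℝ T) :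
    mass T ≤ mass (fun φ => S φ - T φ) + mass S := by
  calc mass T = mass (fun φ => S φ - (S φ - T φ)) := by simp only [sub_sub_cancel]
    _ ≤ mass S + mass (fun φ => S φ - T φ) := mass_sub_le hS (hS.mk' S - hT.mk' T).isLinear
    _ = _ := add_comm _ _

theorem mass_const_mul_le {T : Test N m → ℝ} (hT : IsLinearMap ℝ T) (c : ℝ) :
    mass (fun φ => c * T φ) ≤ ‖c‖ₑ * mass T := by
  refine mass_le_of_forall_enorm_le (c • hT.mk' T).isLinear fun φ => ?_
  calc ‖c * T φ‖ₑ = ‖c‖ₑ * ‖T φ‖ₑ := enorm_mul _ _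
    _ ≤ ‖c‖ₑ * (mass T * ‖φ.toC0‖ₑ) := by gcongr; exact enorm_le_mass_mul hT φ
    _ = _ := (mul_assoc _ _ _).symm

/-- The total variation is lower semicontinuous under convergence of distributions. -/
theorem mass_le_of_tendsto {T : ℕ → Test N m → ℝ} {T' : Test N m → ℝ}
    (hT : ∀ n, IsLinearMap ℝ (T n)) (hT' : IsLinearMap ℝ T')
    (h : ∀ φ, Tendsto (fun n => T n φ) atTop (𝓝 (T' φ))) {L : ℝ≥0∞}
    (hL : Tendsto (fun n => mass (T n)) atTop (𝓝 L)) : mass T' ≤ L := by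
  refine mass_le_of_forall_enorm_le hT' fun φ => ?_
  rcases eq_or_ne φ.toC0 0 with h0 | h0
  · have : φ = 0 := Test.toC0Linear_injective (h0.trans (map_zero (Test.toC0Linear N m)).symm)
    rw [this, hT'.map_zero, enorm_zero]
    exact zero_le
  refine le_of_tendsto_of_tendsto' (h φ).enorm
    (ENNReal.Tendsto.mul_const hL (Or.inr (by simp))) fun n => enorm_le_mass_mul (hT n) φ

theorem mass_le_of_tendsto_of_le {T : ℕ → Test N m → ℝ} {T' : Test N m → ℝ}
    (hT : ∀ n, IsLinearMap ℝ (T n)) (hT' : IsLinearMap ℝ T')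
    (h : ∀ φ, Tendsto (fun n => T n φ) atTop (𝓝 (T' φ))) {C : ℝ≥0∞}
    (hC : ∀ n, mass (T n) ≤ C) : mass T' ≤ C := by
  refine mass_le_of_forall_enorm_le hT' fun φ => ?_
  refine le_of_tendsto' (h φ).enorm fun n => (enorm_le_mass_mul (hT n) φ).trans ?_
  gcongr
  exact hC n

theorem eq_zero_of_mass_eq_zero {T : Test N m → ℝ} (hT : IsLinearMap ℝ T) (h : mass T = 0)
    (φ : Test N m) : T φ = 0 := by
  simpa [h] using enorm_le_mass_mul hT φ

end

section

variable {N m l : ℕ}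

/-! ### Pairings -/

instance (N : ℕ) : IsFiniteMeasure (cubeVol N) := by
  refine ⟨?_⟩
  have h0 : cubeVol N univ = volume (cube N : Set (EuclideanSpace ℝ (Fin N))) := by
    refine (comap_subtype_coe_apply (cube N).isOpen.measurableSet _ _).trans ?_
    rw [image_univ, Subtype.range_coe]
  rw [h0]
  have h : (cube N : Set (EuclideanSpace ℝ (Fin N))) ⊆
      WithLp.ofLp ⁻¹' Metric.closedBall (0 : Fin N → ℝ) 1 := by
    intro x hx
    rw [mem_preimage, mem_closedBall_zero_iff, pi_norm_le_iff_of_nonneg zero_le_one]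
    intro i
    have := hx i
    rw [Real.norm_eq_abs, abs_le]
    constructor <;> linarith [this.1, this.2]
  refine (measure_mono h).trans_lt ?_
  rw [(PiLp.volume_preserving_ofLp (Fin N)).measure_preimage
    Metric.isClosed_closedBall.nullMeasurableSet]
  exact measure_closedBall_lt_top

/-- The space of bounded continuous scalar functions on `ℝ^N`. -/
abbrev Bdd (N : ℕ) : Type := BoundedContinuousFunction (EuclideanSpace ℝ (Fin N)) ℝ

theorem integrable_mul_bdd (u : L1R N) (g : Bdd N) :
    Integrable (fun x : cube N => u x * g x) (cubeVol N) :=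
  (L1.integrable_coeFn u).mul_bdd (c := ‖g‖)
    (g.continuous.comp continuous_subtype_val).aestronglyMeasurable
    (Eventually.of_forall fun x => g.norm_coe_le_norm x)

theorem norm_integral_mul_bdd_le (u : L1R N) (g : Bdd N) :
    ‖∫ x : cube N, u x * g x ∂cubeVol N‖ ≤ ‖u‖ * ‖g‖ := by
  rw [L1.norm_eq_integral_norm, ← integral_mul_const]
  refine norm_integral_le_of_norm_le ((L1.integrable_coeFn u).norm.mul_const _)
    (Eventually.of_forall fun x => ?_)
  rw [norm_mul]
  gcongr
  exact g.norm_coe_le_norm x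

/-- The pairing `(u, g) ↦ ∫_Q u g`. -/
def pairing (N : ℕ) : L1R N →L[ℝ] Bdd N →L[ℝ] ℝ :=
  LinearMap.mkContinuous₂
    (LinearMap.mk₂ ℝ (fun u g => ∫ x : cube N, u x * g x ∂cubeVol N)
      (fun u v g => by
        rw [← integral_add (integrable_mul_bdd u g) (integrable_mul_bdd v g)]
        refine integral_congr_ae ?_
        filter_upwards [Lp.coeFn_add u v] with x hx
        rw [hx, Pi.add_apply, add_mul])
      (fun c u g => by
        rw [smul_eq_mul, ← integral_const_mul]
        refine integral_congr_ae ?_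
        filter_upwards [Lp.coeFn_smul c u] with x hx
        rw [hx, Pi.smul_apply, smul_eq_mul, mul_assoc])
      (fun u g h => by
        rw [← integral_add (integrable_mul_bdd u g) (integrable_mul_bdd u h)]
        simp only [BoundedContinuousFunction.add_apply, mul_add])
      (fun c u g => by
        rw [smul_eq_mul, ← integral_const_mul]
        simp only [BoundedContinuousFunction.smul_apply, smul_eq_mul, mul_left_comm]))
    1 (fun u g => by rw [one_mul]; exact norm_integral_mul_bdd_le u g)

theorem pairing_apply (u : L1R N) (g : Bdd N) :
    pairing N u g = ∫ x : cube N, u x * g x ∂cubeVol N := rfl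

theorem norm_pairing_le (u : L1R N) (g : Bdd N) : ‖pairing N u g‖ ≤ ‖u‖ * ‖g‖ :=
  norm_integral_mul_bdd_le u g

/-- The component `v_K` of an `L¹` function. -/
def component (N m : ℕ) (K : Fin m → Fin N) : L1 N m →L[ℝ] L1R N :=
  (EuclideanSpace.proj (𝕜 := ℝ) K).compLpL 1 (cubeVol N)

theorem coeFn_component (K : Fin m → Fin N) (v : L1 N m) :
    component N m K v =ᵐ[cubeVol N] fun x => v x K :=
  ContinuousLinearMap.coeFn_compLpL (EuclideanSpace.proj (𝕜 := ℝ) K) v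

theorem pairing_component (K : Fin m → Fin N) (v : L1 N m) (g : Bdd N) :
    pairing N (component N m K v) g = ∫ x : cube N, v x K * g x ∂cubeVol N := by
  rw [pairing_apply]
  refine integral_congr_ae ?_
  filter_upwards [coeFn_component K v] with x hx
  rw [hx]

theorem integrable_component_mul (K : Fin m → Fin N) (v : L1 N m) (g : Bdd N) :
    Integrable (fun x : cube N => v x K * g x) (cubeVol N) := by
  refine (integrable_mul_bdd (component N m K v) g).congr ?_
  filter_upwards [coeFn_component K v] with x hx
  rw [hx]

/-- The component `φ_J` of a test function. -/
def Test.component (N m : ℕ) (J : Fin m → Fin N) : Test N m →ₗ[ℝ] Bdd N :=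
  (TestFunction.toBoundedContinuousFunctionCLM ℝ ∘L
    TestFunction.postcompCLM (EuclideanSpace.proj (𝕜 := ℝ) J)).toLinearMap

@[simp]
theorem Test.component_apply (J : Fin m → Fin N) (φ : Test N m)
    (x : EuclideanSpace ℝ (Fin N)) : Test.component N m J φ x = φ x J := rfl

/-- The partial derivative of a test function, as a test function. -/
def Test.partialDeriv (N m : ℕ) (i : Fin N) : Test N m →ₗ[ℝ] Test N m :=
  (TestFunction.lineDerivCLM ℝ (EuclideanSpace.single i 1)).toLinearMap

@[simp]
theorem Test.partialDeriv_apply (i : Fin N) (φ : Test N m) (x : EuclideanSpace ℝ (Fin N)) :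
    Test.partialDeriv N m i φ x = pderiv i φ x := by
  have h : Test.partialDeriv N m i φ x = lineDeriv ℝ φ x (EuclideanSpace.single i 1) := by
    refine (TestFunction.lineDerivCLM_apply (𝕜 := ℝ) (k := ⊤)).trans ?_
    rw [if_pos (by simp)]
  rw [h]
  exact (φ.contDiff.differentiable (by simp) x).lineDeriv_eq_fderiv

/-! ### The distributions in terms of pairings -/

/-- As finite sums of values of the continuous bilinear `pairing`, this distribution and the next
two are visibly linear in the test function and continuous in the `L¹` function. -/
theorem toDist_eq_sum (w : L1 N m) (φ : Test N m) :
    toDist w φ = ∑ J, pairing N (component N m J w) (Test.component N m J φ) := by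
  simp only [pairing_component, toDist]
  exact integral_finsetSum _ fun J _ => integrable_component_mul J w (Test.component N m J φ)

theorem distGrad_eq_sum (u : L1R N) (φ : Test N 1) :
    distGrad u φ =
      -∑ i, pairing N u (Test.component N 1 (fun _ => i) (Test.partialDeriv N 1 i φ)) := by
  simp only [pairing_apply, distGrad, Finset.mul_sum]
  rw [integral_finsetSum _ fun i _ => ?_]
  · simp
  · simpa using integrable_mul_bdd u (Test.component N 1 (fun _ => i) (Test.partialDeriv N 1 i φ))

theorem distOp_eq_sum (B : DiffOp N l) (v : L1 N l) (φ : Test N (l + 1)) :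
    distOp B v φ = -∑ i, ∑ J, ∑ K, B i (J, K) *
      pairing N (component N l K v)
        (Test.component N (l + 1) J (Test.partialDeriv N (l + 1) i φ)) := by
  have h : ∀ i J K, Integrable (fun x : cube N => B i (J, K) * v x K * pderiv i φ x J)
      (cubeVol N) := fun i J K => by
    simpa [mul_assoc] using (integrable_component_mul K v
      (Test.component N (l + 1) J (Test.partialDeriv N (l + 1) i φ))).const_mul (B i (J, K))
  rw [distOp, integral_finsetSum _ fun i _ => integrable_finsetSum _ fun J _ =>
    integrable_finsetSum _ fun K _ => h i J K]
  congr 1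
  refine Finset.sum_congr rfl fun i _ => ?_
  rw [integral_finsetSum _ fun J _ => integrable_finsetSum _ fun K _ => h i J K]
  refine Finset.sum_congr rfl fun J _ => ?_
  rw [integral_finsetSum _ fun K _ => h i J K]
  refine Finset.sum_congr rfl fun K _ => ?_
  rw [pairing_component, ← integral_const_mul]
  simp [mul_assoc]

theorem isLinearMap_toDist (w : L1 N m) : IsLinearMap ℝ (toDist w) where
  map_add φ ψ := by simp only [toDist_eq_sum, map_add, Finset.sum_add_distrib]
  map_smul c φ := by simp only [toDist_eq_sum, map_smul, Finset.smul_sum]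

theorem isLinearMap_distGrad (u : L1R N) : IsLinearMap ℝ (distGrad u) where
  map_add φ ψ := by
    simp only [distGrad_eq_sum, map_add, Finset.sum_add_distrib, neg_add]
  map_smul c φ := by simp only [distGrad_eq_sum, map_smul, Finset.smul_sum, smul_neg]

theorem isLinearMap_distOp (B : DiffOp N l) (v : L1 N l) : IsLinearMap ℝ (distOp B v) where
  map_add φ ψ := by
    simp only [distOp_eq_sum, map_add, mul_add, Finset.sum_add_distrib, neg_add]
  map_smul c φ := by
    simp only [distOp_eq_sum, map_smul, mul_smul_comm, ← Finset.smul_sum, smul_neg]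

theorem isLinearMap_sub {S T : Test N m → ℝ} (hS : IsLinearMap ℝ S) (hT : IsLinearMap ℝ T) :
    IsLinearMap ℝ fun φ => S φ - T φ :=
  (hS.mk' S - hT.mk' T).isLinear

theorem toDist_smul (c : ℝ) (w : L1 N m) (φ : Test N m) :
    toDist (c • w) φ = c * toDist w φ := by
  simp only [toDist_eq_sum, map_smul, Finset.mul_sum, smul_apply, smul_eq_mul]

theorem toDist_sub (v w : L1 N m) (φ : Test N m) :
    toDist (v - w) φ = toDist v φ - toDist w φ := by
  simp only [toDist_eq_sum, map_sub, sub_apply, Finset.sum_sub_distrib]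

theorem distGrad_smul (c : ℝ) (u : L1R N) (φ : Test N 1) :
    distGrad (c • u) φ = c * distGrad u φ := by
  simp only [distGrad_eq_sum, map_smul, Finset.mul_sum, mul_neg, smul_apply, smul_eq_mul]

theorem distOp_smul (B : DiffOp N l) (c : ℝ) (v : L1 N l) (φ : Test N (l + 1)) :
    distOp B (c • v) φ = c * distOp B v φ := by
  simp only [distOp_eq_sum, map_smul, smul_apply, mul_smul_comm, ← Finset.smul_sum]
  rw [← smul_neg, smul_eq_mul]

theorem toDist_zero (φ : Test N m) : toDist (0 : L1 N m) φ = 0 := by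
  simp [toDist_eq_sum]

theorem distGrad_zero (φ : Test N 1) : distGrad (0 : L1R N) φ = 0 := by
  simp [distGrad_eq_sum]

theorem distOp_zero (B : DiffOp N l) (φ : Test N (l + 1)) : distOp B (0 : L1 N l) φ = 0 := by
  simp [distOp_eq_sum]

/-! ### Continuity of the distributions -/

theorem tendsto_pairing_component {v : ℕ → L1 N m} {v' : L1 N m} (h : Tendsto v atTop (𝓝 v'))
    (K : Fin m → Fin N) (g : Bdd N) :
    Tendsto (fun n => pairing N (component N m K (v n)) g) atTop
      (𝓝 (pairing N (component N m K v') g)) :=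
  (((pairing N).flip g ∘L component N m K).continuous.tendsto v').comp h

theorem tendsto_toDist {w : ℕ → L1 N m} {w' : L1 N m} (h : Tendsto w atTop (𝓝 w'))
    (φ : Test N m) : Tendsto (fun n => toDist (w n) φ) atTop (𝓝 (toDist w' φ)) := by
  simp only [toDist_eq_sum]
  exact tendsto_finsetSum _ fun J _ => tendsto_pairing_component h _ _

theorem tendsto_distGrad {u : ℕ → L1R N} {u' : L1R N} (h : Tendsto u atTop (𝓝 u'))
    (φ : Test N 1) : Tendsto (fun n => distGrad (u n) φ) atTop (𝓝 (distGrad u' φ)) := by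
  simp only [distGrad_eq_sum]
  exact (tendsto_finsetSum _ fun i _ =>
    (((pairing N).flip _).continuous.tendsto u').comp h).neg

/-- Since derivatives fall on `φ`, strong `L¹` convergence of `v n` suffices. This is what
identifies limits with the given limit operator. -/
theorem tendsto_distOp {B : ℕ → DiffOp N l} {B' : DiffOp N l} (hB : Tendsto B atTop (𝓝 B'))
    {v : ℕ → L1 N l} {v' : L1 N l} (h : Tendsto v atTop (𝓝 v')) (φ : Test N (l + 1)) :
    Tendsto (fun n => distOp (B n) (v n) φ) atTop (𝓝 (distOp B' v' φ)) := by
  simp only [distOp_eq_sum]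
  refine (tendsto_finsetSum _ fun i _ => tendsto_finsetSum _ fun J _ =>
    tendsto_finsetSum _ fun K _ => ?_).neg
  refine Tendsto.mul ?_ (tendsto_pairing_component h _ _)
  exact ((EuclideanSpace.proj (𝕜 := ℝ) (J, K)).continuous.tendsto (B' i)).comp
    (tendsto_pi_nhds.1 hB i)

theorem tendsto_of_opNorm_sub {B : ℕ → DiffOp N l} {B' : DiffOp N l}
    (h : Tendsto (fun n => opNorm (B n - B')) atTop (𝓝 0)) : Tendsto B atTop (𝓝 B') := by
  rw [tendsto_pi_nhds]
  intro i
  rw [tendsto_iff_norm_sub_tendsto_zero]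
  refine squeeze_zero (fun n => norm_nonneg _) (fun n => ?_) h
  exact Finset.single_le_sum (f := fun i => ‖(B n - B') i‖) (fun i _ => norm_nonneg _)
    (Finset.mem_univ i)

/-! ### Integrable functions as measures -/

/-- Cauchy–Schwarz for the Euclidean norm of tensors at each point; equality also holds but is not
needed. -/
theorem mass_toDist_le (w : L1 N m) : mass (toDist w) ≤ ‖w‖ₑ := by
  refine mass_le_of_forall_enorm_le (isLinearMap_toDist w) fun φ => ?_
  have h : ‖toDist w φ‖ ≤ ‖w‖ * ‖φ.toC0‖ := by
    rw [L1.norm_eq_integral_norm, ← integral_mul_const, toDist]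
    refine norm_integral_le_of_norm_le ((L1.integrable_coeFn w).norm.mul_const _)
      (Eventually.of_forall fun x => ?_)
    calc ‖∑ J, w x J * φ x J‖ = ‖inner ℝ (φ x) (w x)‖ := by simp [PiLp.inner_apply]
      _ ≤ ‖φ x‖ * ‖w x‖ := norm_inner_le_norm _ _
      _ ≤ ‖w x‖ * ‖φ.toC0‖ := by rw [mul_comm]; gcongr; exact φ.norm_apply_le x
  simp only [← ofReal_norm]
  rw [← ENNReal.ofReal_mul (norm_nonneg _)]
  exact ENNReal.ofReal_le_ofReal h

end

section

variable {N m l : ℕ}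

/-! ### Extension by zero -/

/-- The extension by zero to `ℝ^N` of a function on the cube. -/
def zeroExt {F : Type*} [Zero F] (f : cube N → F) : EuclideanSpace ℝ (Fin N) → F :=
  Function.extend Subtype.val f 0

@[simp]
theorem zeroExt_coe {F : Type*} [Zero F] (f : cube N → F) (x : cube N) : zeroExt f x = f x :=
  Subtype.val_injective.extend_apply f 0 x

theorem zeroExt_of_notMem {F : Type*} [Zero F] (f : cube N → F) {x : EuclideanSpace ℝ (Fin N)}
    (hx : x ∉ cube N) : zeroExt f x = 0 :=
  Function.extend_apply' (f := Subtype.val) f (0 : EuclideanSpace ℝ (Fin N) → F) x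
    (by rintro ⟨y, rfl⟩; exact hx y.2)

theorem measurableEmbedding_cube (N : ℕ) :
    MeasurableEmbedding (Subtype.val : cube N → EuclideanSpace ℝ (Fin N)) :=
  MeasurableEmbedding.subtype_coe (cube N).isOpen.measurableSet

theorem map_cubeVol (N : ℕ) :
    (cubeVol N).map (Subtype.val : cube N → EuclideanSpace ℝ (Fin N)) =
      volume.restrict (cube N : Set (EuclideanSpace ℝ (Fin N))) := by
  rw [cubeVol, (measurableEmbedding_cube N).map_comap, Subtype.range_coe]

theorem integral_cubeVol {F : Type*} [NormedAddCommGroup F] [NormedSpace ℝ F]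
    (f : EuclideanSpace ℝ (Fin N) → F) :
    ∫ x : cube N, f x ∂cubeVol N = ∫ x in (cube N : Set (EuclideanSpace ℝ (Fin N))), f x := by
  rw [← map_cubeVol, (measurableEmbedding_cube N).integral_map]

theorem ae_cubeVol_iff {p : EuclideanSpace ℝ (Fin N) → Prop} :
    (∀ᵐ x : cube N ∂cubeVol N, p x) ↔ ∀ᵐ x, x ∈ cube N → p x := by
  rw [← (measurableEmbedding_cube N).ae_map_iff (p := p), map_cubeVol,
    ae_restrict_iff' (cube N).isOpen.measurableSet]
  rfl

theorem integrable_zeroExt {F : Type*} [NormedAddCommGroup F] {f : cube N → F}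
    (hf : Integrable f (cubeVol N)) : Integrable (zeroExt f) volume := by
  have h : IntegrableOn (zeroExt f) (cube N) volume := by
    rw [IntegrableOn, ← map_cubeVol, (measurableEmbedding_cube N).integrable_map_iff]
    exact hf.congr (Eventually.of_forall fun x => (zeroExt_coe f x).symm)
  refine (integrableOn_iff_integrable_of_support_subset fun x hx => ?_).1 h
  by_contra hx'
  exact hx (zeroExt_of_notMem f hx')

theorem integral_mul_eq_integral_zeroExt_mul (f : cube N → ℝ) (g : EuclideanSpace ℝ (Fin N) → ℝ) :
    ∫ x : cube N, f x * g x ∂cubeVol N = ∫ x, zeroExt f x * g x := by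
  calc _ = ∫ x : cube N, (fun y => zeroExt f y * g y) x ∂cubeVol N := by simp
    _ = ∫ x in (cube N : Set (EuclideanSpace ℝ (Fin N))), zeroExt f x * g x :=
      integral_cubeVol fun y => zeroExt f y * g y
    _ = _ := setIntegral_eq_integral_of_forall_compl_eq_zero fun x hx => by
      rw [zeroExt_of_notMem f hx, zero_mul]

/-- The test function `g e_J`, for a scalar function `g`. -/
def Test.single (J : Fin m → Fin N) (g : EuclideanSpace ℝ (Fin N) → ℝ) (hg : ContDiff ℝ ∞ g)
    (hs : HasCompactSupport g) (ht : tsupport g ⊆ cube N) : Test N m where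
  toFun x := g x • EuclideanSpace.single J (1 : ℝ)
  contDiff' := hg.smul contDiff_const
  hasCompactSupport' := hs.smul_right
  tsupport_subset' := (tsupport_smul_subset_left g _).trans ht

/-- The fundamental lemma of the calculus of variations, applied to the zero extension of each
component with test functions `g e_J`. -/
theorem toDist_injective {w : L1 N m} (h : ∀ φ, toDist w φ = 0) : w = 0 := by
  have hJ : ∀ J, ∀ᵐ x ∂cubeVol N, w x J = 0 := fun J => by
    have h0 := (cube N).isOpen.ae_eq_zero_of_integral_contDiff_smul_eq_zero (μ := volume)
      (f := zeroExt (component N m J w))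
      ((integrable_zeroExt (L1.integrable_coeFn _)).locallyIntegrable.locallyIntegrableOn _)
      fun g hg hs ht => by
        have h1 := h (Test.single J g hg hs ht)
        rw [toDist] at h1
        rw [← h1]
        calc ∫ x, g x • zeroExt (component N m J w) x
            = ∫ x : cube N, component N m J w x * g x ∂cubeVol N := by
              rw [integral_mul_eq_integral_zeroExt_mul]
              simp only [smul_eq_mul, mul_comm]
          _ = _ := by
              refine integral_congr_ae ?_
              filter_upwards [coeFn_component J w] with x hx
              rw [hx, Finset.sum_eq_single J]
              · change _ = w x J * (g x • EuclideanSpace.single J (1 : ℝ)).ofLp J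
                simp
              · intro J' _ hJ'
                change w x J' * (g x • EuclideanSpace.single J (1 : ℝ)).ofLp J' = 0
                simp [hJ']
              · simp
    filter_upwards [ae_cubeVol_iff.2 h0, coeFn_component J w] with x hx hx'
    rw [← hx', ← hx, zeroExt_coe]
  rw [Lp.eq_zero_iff_ae_eq_zero]
  filter_upwards [ae_all_iff.2 hJ] with x hx
  ext J
  exact hx J

/-! ### Density of test functions in `C₀` -/

theorem C0.exists_isCompact_norm_lt (ψ : C0 N m) {δ : ℝ} (hδ : 0 < δ) :
    ∃ K : Set (cube N), IsCompact K ∧ ∀ x ∉ K, ‖ψ x‖ < δ := by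
  have h : Tendsto ψ (cocompact (cube N)) (𝓝 0) :=
    ZeroAtInftyContinuousMap.zero_at_infty' (α := cube N) (β := Tensor N m) ψ
  obtain ⟨K, hK, hKψ⟩ := mem_cocompact.1 (h (Metric.ball_mem_nhds 0 hδ))
  exact ⟨K, hK, fun x hx => by simpa using hKψ hx⟩

/-- At a point off `Q`, a neighbourhood avoids the compact set outside which `ψ` is small. -/
theorem C0.continuous_zeroExt (ψ : C0 N m) : Continuous (zeroExt ψ) := by
  rw [continuous_iff_continuousAt]
  intro x
  by_cases hx : x ∈ cube N
  · have hψ : Continuous ψ :=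
      map_continuous (F := C₀(cube N, Tensor N m)) ψ
    rw [← (cube N).isOpen.isOpenEmbedding_subtypeVal.continuousAt_iff (x := ⟨x, hx⟩)]
    refine hψ.continuousAt.congr (Eventually.of_forall fun y => ?_)
    simp
  · rw [ContinuousAt, zeroExt_of_notMem _ hx, Metric.tendsto_nhds]
    intro δ hδ
    obtain ⟨K, hK, hKψ⟩ := ψ.exists_isCompact_norm_lt hδ
    have hmem : (Subtype.val '' K)ᶜ ∈ 𝓝 x := by
      refine (hK.image continuous_subtype_val).isClosed.isOpen_compl.mem_nhds ?_
      rintro ⟨y, -, rfl⟩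
      exact hx y.2
    filter_upwards [hmem] with y hy
    rw [dist_zero_right]
    by_cases hy' : y ∈ cube N
    · have := hKψ ⟨y, hy'⟩ fun h => hy ⟨_, h, rfl⟩
      rwa [← zeroExt_coe ψ ⟨y, hy'⟩] at this
    · rwa [zeroExt_of_notMem _ hy', norm_zero]

/-- Shrinking the values of `ψ` radially by at most `δ` kills it wherever `‖ψ‖ ≤ δ`, which makes the
support compact in `Q`. A smooth approximation within `δ` then finishes. -/
theorem exists_test_norm_sub_le (ψ : C0 N m) {ε : ℝ} (hε : 0 < ε) :
    ∃ φ : Test N m, ‖ψ - φ.toC0‖ ≤ ε := by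
  obtain ⟨δ, hδ, hδε⟩ : ∃ δ > 0, δ + δ = ε := ⟨ε / 2, half_pos hε, add_halves ε⟩
  obtain ⟨K, hK, hKψ⟩ := ψ.exists_isCompact_norm_lt hδ
  -- `c t * t = (t - δ)⁺` for `t ≥ 0`; the maximum in the denominator keeps `c` continuous at `0`.
  let c : ℝ → ℝ := fun t => max (t - δ) 0 / max t δ
  have hmax : ∀ t : ℝ, max t δ ≠ 0 := fun t => (lt_max_of_lt_right hδ).ne'
  have hc : Continuous c := by
    refine Continuous.div (by fun_prop) (by fun_prop) hmax
  let f : EuclideanSpace ℝ (Fin N) → Tensor N m := fun x => c ‖zeroExt ψ x‖ • zeroExt ψ x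
  have hf : Continuous f := (hc.comp ψ.continuous_zeroExt.norm).smul ψ.continuous_zeroExt
  have hsupp : Function.support f ⊆ Subtype.val '' K := by
    intro x hx
    by_contra hxK
    refine hx ?_
    by_cases hxQ : x ∈ cube N
    · have h1 : ‖zeroExt ψ x‖ < δ := by
        have := hKψ ⟨x, hxQ⟩ fun h => hxK ⟨_, h, rfl⟩
        rwa [← zeroExt_coe ψ ⟨x, hxQ⟩] at this
      simp [f, c, max_eq_right (sub_nonpos.2 h1.le)]
    · simp [f, zeroExt_of_notMem _ hxQ]
  have hfψ : ∀ x, ‖zeroExt ψ x - f x‖ ≤ δ := fun x => by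
    have h1 : zeroExt ψ x - f x = (1 - c ‖zeroExt ψ x‖) • zeroExt ψ x := by
      rw [sub_smul, one_smul]
    rw [h1, norm_smul]
    rcases le_total ‖zeroExt ψ x‖ δ with h2 | h2
    · simp [c, h2]
    · have h3 : 0 < ‖zeroExt ψ x‖ := hδ.trans_le h2
      have h4 : 1 - c ‖zeroExt ψ x‖ = δ / ‖zeroExt ψ x‖ := by
        simp only [c, max_eq_left h2, max_eq_left (sub_nonneg.2 h2)]
        field_simp
        ring
      rw [h4, Real.norm_of_nonneg (by positivity), div_mul_cancel₀ _ h3.ne']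
  have hKc : IsCompact (Subtype.val '' K : Set (EuclideanSpace ℝ (Fin N))) :=
    hK.image continuous_subtype_val
  -- The approximation has its support inside that of `f`, so it stays in `Q`.
  obtain ⟨g, hg, hgf, hgs⟩ := hf.exists_contDiff_approx ⊤ (ε := fun _ => δ) continuous_const
    fun _ => hδ
  have ht : tsupport g ⊆ Subtype.val '' K := closure_minimal (hgs.trans hsupp) hKc.isClosed
  let φ : Test N m := ⟨g, hg, hKc.of_isClosed_subset (isClosed_tsupport g) ht,
    ht.trans (by rintro _ ⟨y, -, rfl⟩; exact y.2)⟩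
  refine ⟨φ, C0.norm_le hε.le fun x => ?_⟩
  have h1 : (ψ - φ.toC0) x = (zeroExt ψ x - f x) + (f x - g x) := by
    rw [sub_add_sub_cancel, zeroExt_coe]
    rfl
  rw [h1, ← hδε]
  refine (norm_add_le _ _).trans (add_le_add (hfψ x) ?_)
  rw [← dist_eq_norm, dist_comm]
  exact (hgf x).le

/-- Bounded measures that converge as distributions converge weakly*. -/
theorem measWeakStar_of_tendsto {T : ℕ → Test N m → ℝ} {T' : Test N m → ℝ}
    (hT : ∀ n, IsLinearMap ℝ (T n)) (hT' : IsLinearMap ℝ T')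
    (h : ∀ φ, Tendsto (fun n => T n φ) atTop (𝓝 (T' φ))) {C : ℝ≥0∞} (hC : C ≠ ⊤)
    (hTC : ∀ n, mass (T n) ≤ C) : MeasWeakStar T T' := by
  -- `mass` is an infimum, so one unit of slack is spent to pick representing measures of bounded
  -- norm.
  have hlt : C < C + 1 := ENNReal.lt_add_right hC one_ne_zero
  have htop : C + 1 ≠ ⊤ := by simp [hC]
  obtain ⟨μ', hμ', hn'⟩ :=
    IsMeas.exists_of_mass_lt ((mass_le_of_tendsto_of_le hT hT' h hTC).trans_lt hlt)
  choose μ hμ hn using fun n => IsMeas.exists_of_mass_lt ((hTC n).trans_lt hlt)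
  set R := (C + 1).toReal
  have hbd : ∀ ν : Mb N m, ENNReal.ofReal ‖ν‖ < C + 1 → ‖ν‖ ≤ R := fun ν hν =>
    ((ENNReal.ofReal_lt_iff_lt_toReal (norm_nonneg _) htop).1 hν).le
  have hR : 0 ≤ R := ENNReal.toReal_nonneg
  refine ⟨μ, μ', hμ, hμ', fun ψ => ?_⟩
  rw [Metric.tendsto_atTop]
  intro ε hε
  -- The two errors from replacing `ψ` by `φ` cost `ε / 4` each and convergence at `φ` costs `ε /
  -- 2`; `R + 1` keeps the denominator positive.
  obtain ⟨φ, hφ⟩ := exists_test_norm_sub_le ψ (ε := ε / (4 * (R + 1))) (by positivity)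
  have hconv : Tendsto (fun n => μ n φ.toC0) atTop (𝓝 (μ' φ.toC0)) := by
    simpa only [hμ _ φ, hμ' φ] using h φ
  obtain ⟨n₀, hn₀⟩ := Metric.tendsto_atTop.1 hconv (ε / 2) (half_pos hε)
  refine ⟨n₀, fun n hnn => ?_⟩
  have key : ∀ ν : Mb N m, ‖ν‖ ≤ R → ‖ν (ψ - φ.toC0)‖ ≤ ε / 4 := fun ν hν => by
    calc ‖ν (ψ - φ.toC0)‖ ≤ R * (ε / (4 * (R + 1))) := ν.le_of_opNorm_le_of_le hν hφ
      _ ≤ (R + 1) * (ε / (4 * (R + 1))) := by gcongr; linarith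
      _ = ε / 4 := by field_simp
  have e : μ n ψ - μ' ψ =
      μ n (ψ - φ.toC0) + (μ n φ.toC0 - μ' φ.toC0) - μ' (ψ - φ.toC0) := by
    rw [map_sub, map_sub]; ring
  have h1 := hn₀ n hnn
  rw [dist_eq_norm] at h1 ⊢
  rw [e]
  have h2 := key (μ n) (hbd _ (hn n))
  have h3 := key μ' (hbd _ hn')
  have h4 := norm_sub_le (μ n (ψ - φ.toC0) + (μ n φ.toC0 - μ' φ.toC0)) (μ' (ψ - φ.toC0))
  have h5 := norm_add_le (μ n (ψ - φ.toC0)) (μ n φ.toC0 - μ' φ.toC0)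
  linarith

/-! ### Compactness in `BV(Q)` -/

/-- The `L¹` tensor field `u e_K`, for a scalar function `u`. -/
def ofComponent (N m : ℕ) (K : Fin m → Fin N) : L1R N →L[ℝ] L1 N m :=
  (ContinuousLinearMap.toSpanSingleton ℝ (EuclideanSpace.single K (1 : ℝ))).compLpL 1 (cubeVol N)

theorem coeFn_ofComponent (K : Fin m → Fin N) (u : L1R N) :
    ofComponent N m K u =ᵐ[cubeVol N] fun x => u x • EuclideanSpace.single K (1 : ℝ) :=
  ContinuousLinearMap.coeFn_compLpL
    (ContinuousLinearMap.toSpanSingleton ℝ (EuclideanSpace.single K (1 : ℝ))) u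

theorem component_ofComponent_self (K : Fin m → Fin N) (u : L1R N) :
    component N m K (ofComponent N m K u) = u := by
  refine Lp.ext ?_
  filter_upwards [coeFn_component K (ofComponent N m K u), coeFn_ofComponent K u] with x h1 h2
  rw [h1, h2]
  simp

theorem component_ofComponent_of_ne {K L : Fin m → Fin N} (h : K ≠ L) (u : L1R N) :
    component N m K (ofComponent N m L u) = 0 := by
  refine Lp.ext ?_
  filter_upwards [coeFn_component K (ofComponent N m L u), coeFn_ofComponent L u,
    Lp.coeFn_zero ℝ 1 (cubeVol N)] with x h1 h2 h3
  rw [h1, h2, h3]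
  simp [h]

/-- The coefficients of `𝓑` that act on the component `K`, as a map from tensors to vectors. -/
def coeffMap (B : DiffOp N l) (K : Fin l → Fin N) : Tensor N (l + 1) →L[ℝ] Tensor N 1 :=
  ∑ J, (EuclideanSpace.proj (𝕜 := ℝ) J).smulRight
    (WithLp.toLp 2 fun c : Fin 1 → Fin N => B (c 0) (J, K))

theorem coeffMap_apply (B : DiffOp N l) (K : Fin l → Fin N) (t : Tensor N (l + 1)) (i : Fin N) :
    coeffMap B K t (fun _ => i) = ∑ J, B i (J, K) * t J := by
  simp [coeffMap, sum_apply, mul_comm]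

theorem pderiv_postcompCLM (L : Tensor N m →L[ℝ] Tensor N l) (i : Fin N) (φ : Test N m)
    (x : EuclideanSpace ℝ (Fin N)) :
    pderiv i (TestFunction.postcompCLM L φ : Test N l) x = L (pderiv i φ x) := by
  have h := (L.hasFDerivAt (x := φ x)).comp x
    (φ.contDiff.differentiable (by simp) x).hasFDerivAt
  rw [pderiv, TestFunction.postcompCLM_apply, h.fderiv]
  rfl

/-- On a field with a single component `u`, each component of `𝓑` is a constant combination of the
`∂_i u`, and the constant matrix can be moved onto the test function. It follows that `u ↦ u e_K` is
bounded from `BV` to `BV_𝓑`. -/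
theorem distOp_ofComponent (B : DiffOp N l) (K : Fin l → Fin N) (u : L1R N)
    (φ : Test N (l + 1)) :
    distOp B (ofComponent N l K u) φ =
      distGrad u (TestFunction.postcompCLM (coeffMap B K) φ) := by
  rw [distOp_eq_sum, distGrad_eq_sum]
  congr 1
  refine Finset.sum_congr rfl fun i _ => ?_
  have h : Test.component N 1 (fun _ => i) (Test.partialDeriv N 1 i
      (TestFunction.postcompCLM (coeffMap B K) φ)) =
      ∑ J, B i (J, K) • Test.component N (l + 1) J (Test.partialDeriv N (l + 1) i φ) := by
    ext x
    simp [pderiv_postcompCLM, coeffMap_apply]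
  rw [h, map_sum]
  refine Finset.sum_congr rfl fun J _ => ?_
  rw [Finset.sum_eq_single K (fun K' _ hK' => by simp [component_ofComponent_of_ne hK'])
    (by simp), component_ofComponent_self, map_smul, smul_eq_mul]

theorem mass_distOp_ofComponent_le (B : DiffOp N l) (K : Fin l → Fin N) (u : L1R N) :
    mass (distOp B (ofComponent N l K u)) ≤ ‖coeffMap B K‖ₑ * mass (distGrad u) := by
  refine mass_le_of_forall_enorm_le (isLinearMap_distOp _ _) fun φ => ?_
  rw [distOp_ofComponent]
  refine (enorm_le_mass_mul (isLinearMap_distGrad u) _).trans ?_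
  rw [mul_comm ‖coeffMap B K‖ₑ, mul_assoc]
  gcongr
  simp only [← ofReal_norm]
  rw [← ENNReal.ofReal_mul (norm_nonneg _)]
  refine ENNReal.ofReal_le_ofReal (C0.norm_le (by positivity) fun x => ?_)
  exact ContinuousLinearMap.le_of_opNorm_le_of_le _ le_rfl (φ.norm_apply_le _)

/-- If some `BV_𝓑` embeds compactly into `L¹`, then `BV(Q)` embeds compactly into `L¹(Q)`. -/
theorem Admissible.exists_subseq_tendsto {B : DiffOp N l} (hB : Admissible B) (K : Fin l → Fin N)
    {u : ℕ → L1R N} {R : ℝ} (hu : ∀ n, ‖u n‖ ≤ R) {C : ℝ≥0∞} (hC : C ≠ ⊤)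
    (hD : ∀ n, mass (distGrad (u n)) ≤ C) :
    ∃ (u' : L1R N) (s : ℕ → ℕ), StrictMono s ∧ Tendsto (fun j => u (s j)) atTop (𝓝 u') := by
  have hbd : ∀ n, bvNorm B (ofComponent N l K (u n)) ≤
      ‖ofComponent N l K‖ₑ * ENNReal.ofReal R + ‖coeffMap B K‖ₑ * C := fun n => by
    refine add_le_add ?_ ((mass_distOp_ofComponent_le B K (u n)).trans (by gcongr; exact hD n))
    refine ((ofComponent N l K).le_opENorm _).trans ?_
    gcongr
    rw [← ofReal_norm]
    exact ENNReal.ofReal_le_ofReal (hu n)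
  have hfin : ‖ofComponent N l K‖ₑ * ENNReal.ofReal R + ‖coeffMap B K‖ₑ * C ≠ ⊤ :=
    ENNReal.add_ne_top.2 ⟨ENNReal.mul_ne_top (by simp) (by simp),
      ENNReal.mul_ne_top (by simp) hC⟩
  lift ‖ofComponent N l K‖ₑ * ENNReal.ofReal R + ‖coeffMap B K‖ₑ * C to ℝ≥0 using hfin with M
  obtain ⟨v, -, s, hs, hv⟩ := (hB.compact M).tendsto_subseq
    (x := fun n => ofComponent N l K (u n)) fun n => subset_closure
      ⟨mass_lt_top_iff.1 ((le_add_self.trans (hbd n)).trans_lt ENNReal.coe_lt_top), hbd n⟩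
  refine ⟨component N l K v, s, hs, ?_⟩
  have := ((component N l K).continuous.tendsto v).comp hv
  simpa only [Function.comp_def, component_ofComponent_self] using this

end

section

variable {N k : ℕ}

/-! ### Extraction of subsequences -/

/-- The hypothesis allows an extraction from any given subsequence, so the indices can be treated
one after another. -/
theorem exists_common_subseq {ι : Type*} [Finite ι] {X : ι → Type*} [∀ i, TopologicalSpace (X i)]
    (x : ℕ → ∀ i, X i) (h : ∀ (i : ι) (s : ℕ → ℕ), StrictMono s →
      ∃ t : ℕ → ℕ, StrictMono t ∧ ∃ a, Tendsto (fun j => x (s (t j)) i) atTop (𝓝 a)) :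
    ∃ s : ℕ → ℕ, StrictMono s ∧ ∃ a : ∀ i, X i,
      ∀ i, Tendsto (fun j => x (s j) i) atTop (𝓝 (a i)) := by
  classical
  have := Fintype.ofFinite ι
  have key : ∀ F : Finset ι, ∃ s : ℕ → ℕ, StrictMono s ∧
      ∀ i ∈ F, ∃ a, Tendsto (fun j => x (s j) i) atTop (𝓝 a) := by
    intro F
    induction F using Finset.induction_on with
    | empty => exact ⟨id, strictMono_id, by simp⟩
    | insert i F _ ih =>
      obtain ⟨s, hs, hF⟩ := ih
      obtain ⟨t, ht, hi⟩ := h i s hs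
      refine ⟨s ∘ t, hs.comp ht, fun i' hi' => ?_⟩
      rcases Finset.mem_insert.1 hi' with rfl | hi'
      · exact hi
      · exact (hF i' hi').imp fun a ha => ha.comp ht.tendsto_atTop
  obtain ⟨s, hs, ha⟩ := key Finset.univ
  choose a ha using fun i => ha i (Finset.mem_univ i)
  exact ⟨s, hs, a, ha⟩

/-! ### The auxiliary fields -/

@[simp]
theorem extend_coe (v : (l : Fin k) → L1 N (l + 1)) (l : Fin k) : extend v l = v l :=
  dif_pos l.2

theorem extend_of_le (v : (l : Fin k) → L1 N (l + 1)) {l : ℕ} (h : k ≤ l) : extend v l = 0 :=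
  dif_neg h.not_gt

theorem norm_extend_le {v : (l : Fin k) → L1 N (l + 1)} {R : ℝ} (hR : 0 ≤ R)
    (h : ∀ l, ‖v l‖ ≤ R) (l : ℕ) : ‖extend v l‖ ≤ R := by
  by_cases hl : l < k
  · exact (congrArg norm (extend_coe v ⟨l, hl⟩)).trans_le (h _)
  · rw [extend_of_le v (not_lt.1 hl), norm_zero]
    exact hR

theorem extend_smul (c : ℝ) (v : (l : Fin k) → L1 N (l + 1)) (l : ℕ) :
    extend (c • v) l = c • extend v l := by
  unfold extend
  split_ifs <;> simp

theorem tendsto_extend {v : ℕ → (l : Fin k) → L1 N (l + 1)} {v' : (l : Fin k) → L1 N (l + 1)}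
    (h : ∀ l, Tendsto (fun n => v n l) atTop (𝓝 (v' l))) (l : ℕ) :
    Tendsto (fun n => extend (v n) l) atTop (𝓝 (extend v' l)) := by
  unfold extend
  split_ifs with hl
  · exact h ⟨l, hl⟩
  · exact tendsto_const_nhds

/-- The distribution `Du - v_0`. -/
def gradResidual (u : L1R N) (v : (l : Fin k) → L1 N (l + 1)) (φ : Test N 1) : ℝ :=
  distGrad u φ - toDist (extend v 0) φ

/-- The distribution `v_{l+1} - 𝓑^l v_l`. -/
def opResidual (B : (l : Fin k) → DiffOp N (l + 1)) (v : (l : Fin k) → L1 N (l + 1)) (l : Fin k)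
    (φ : Test N (l + 1 + 1)) : ℝ :=
  toDist (extend v (l + 1)) φ - distOp (B l) (v l) φ

theorem isLinearMap_gradResidual (u : L1R N) (v : (l : Fin k) → L1 N (l + 1)) :
    IsLinearMap ℝ (gradResidual u v) :=
  isLinearMap_sub (isLinearMap_distGrad _) (isLinearMap_toDist _)

theorem isLinearMap_opResidual (B : (l : Fin k) → DiffOp N (l + 1))
    (v : (l : Fin k) → L1 N (l + 1)) (l : Fin k) : IsLinearMap ℝ (opResidual B v l) :=
  isLinearMap_sub (isLinearMap_toDist _) (isLinearMap_distOp _ _)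

theorem gradResidual_smul (c : ℝ) (u : L1R N) (v : (l : Fin k) → L1 N (l + 1)) :
    gradResidual (c • u) (c • v) = fun φ => c * gradResidual u v φ := by
  ext φ
  rw [gradResidual, gradResidual, extend_smul, distGrad_smul, toDist_smul, mul_sub]

theorem opResidual_smul (c : ℝ) (B : (l : Fin k) → DiffOp N (l + 1))
    (v : (l : Fin k) → L1 N (l + 1)) (l : Fin k) :
    opResidual B (c • v) l = fun φ => c * opResidual B v l φ := by
  ext φ
  rw [opResidual, opResidual, extend_smul, Pi.smul_apply, distOp_smul, toDist_smul, mul_sub]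

theorem tendsto_gradResidual {u : ℕ → L1R N} {u' : L1R N} (hu : Tendsto u atTop (𝓝 u'))
    {v : ℕ → (l : Fin k) → L1 N (l + 1)} {v' : (l : Fin k) → L1 N (l + 1)}
    (h : ∀ l, Tendsto (fun n => v n l) atTop (𝓝 (v' l))) (φ : Test N 1) :
    Tendsto (fun n => gradResidual (u n) (v n) φ) atTop (𝓝 (gradResidual u' v' φ)) :=
  (tendsto_distGrad hu φ).sub (tendsto_toDist (tendsto_extend h 0) φ)

theorem tendsto_opResidual {B : ℕ → (l : Fin k) → DiffOp N (l + 1)}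
    {B' : (l : Fin k) → DiffOp N (l + 1)} (hB : ∀ l, Tendsto (fun n => B n l) atTop (𝓝 (B' l)))
    {v : ℕ → (l : Fin k) → L1 N (l + 1)} {v' : (l : Fin k) → L1 N (l + 1)}
    (h : ∀ l, Tendsto (fun n => v n l) atTop (𝓝 (v' l))) (l : Fin k) (φ : Test N (l + 1 + 1)) :
    Tendsto (fun n => opResidual (B n) (v n) l φ) atTop (𝓝 (opResidual B' v' l φ)) :=
  (tendsto_toDist (tendsto_extend h (l + 1)) φ).sub (tendsto_distOp (hB l) (h l) φ)

theorem enorm_le_ofReal {E : Type*} [SeminormedAddCommGroup E] {x : E} {R : ℝ} (h : ‖x‖ ≤ R) :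
    ‖x‖ₑ ≤ ENNReal.ofReal R := by
  rw [← ofReal_norm]
  exact ENNReal.ofReal_le_ofReal h

/-- `𝓑^l v_l` differs from the residual by the `L¹` function `v_{l+1}`, which is `0` for the last
`l`. -/
theorem mass_distOp_le {B : (l : Fin k) → DiffOp N (l + 1)} {v : (l : Fin k) → L1 N (l + 1)}
    {R : ℝ} (hR : 0 ≤ R) (hv : ∀ l, ‖v l‖ ≤ R) {C : ℝ≥0∞} (l : Fin k)
    (h : mass (opResidual B v l) ≤ C) :
    mass (distOp (B l) (v l)) ≤ C + ENNReal.ofReal R :=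
  (mass_le_of_sub' (isLinearMap_toDist (extend v (l + 1))) (isLinearMap_distOp _ _)).trans
    (add_le_add h ((mass_toDist_le _).trans (enorm_le_ofReal (norm_extend_le hR hv _))))

theorem mass_distGrad_le {u : L1R N} {v : (l : Fin k) → L1 N (l + 1)}
    {R : ℝ} (hR : 0 ≤ R) (hv : ∀ l, ‖v l‖ ≤ R) {C : ℝ≥0∞} (h : mass (gradResidual u v) ≤ C) :
    mass (distGrad u) ≤ C + ENNReal.ofReal R :=
  (mass_le_of_sub (isLinearMap_distGrad u) (isLinearMap_toDist (extend v 0))).trans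
    (add_le_add h ((mass_toDist_le _).trans (enorm_le_ofReal (norm_extend_le hR hv _))))

theorem continuous_opNorm (N l : ℕ) : Continuous (opNorm : DiffOp N l → ℝ) := by
  unfold opNorm
  fun_prop

/-- A sequence of tuples of admissible operators, with the compactness and closure property, that
converges. -/
structure ConvergentFamily (B : ℕ → (l : Fin k) → DiffOp N (l + 1))
    (B' : (l : Fin k) → DiffOp N (l + 1)) : Prop where
  admissible : ∀ n l, Admissible (B n l)
  compactClosed : ∀ l, CompactClosed (Set.range fun n => B n l)
  tendsto : ∀ l, Tendsto (fun n => B n l) atTop (𝓝 (B' l))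

/-! ### Compactness and a priori bound for the auxiliary fields. -/

namespace ConvergentFamily

variable {B : ℕ → (l : Fin k) → DiffOp N (l + 1)} {B' : (l : Fin k) → DiffOp N (l + 1)}

theorem comp (h : ConvergentFamily B B') {s : ℕ → ℕ} (hs : StrictMono s) :
    ConvergentFamily (fun j => B (s j)) B' where
  admissible n l := h.admissible _ l
  compactClosed l A v hA := h.compactClosed l A v fun n => by
    obtain ⟨j, hj⟩ := hA n
    exact ⟨s j, hj⟩
  tendsto l := (h.tendsto l).comp hs.tendsto_atTop

/-- Only the strong `L¹` convergence is kept from property (C). The limit operator it supplies is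
discarded, because convergence of the coefficients identifies the limit as `B'` acting on `v'`. -/
theorem exists_subseq_tendsto (h : ConvergentFamily B B') {v : ℕ → (l : Fin k) → L1 N (l + 1)}
    (hv : ∀ n l, v n l ∈ BVOp (B n l)) {R : ℝ} (hR : ∀ n l, ‖v n l‖ ≤ R) {C : ℝ≥0∞} (hC : C ≠ ⊤)
    (hmass : ∀ n l, mass (distOp (B n l) (v n l)) ≤ C) :
    ∃ s : ℕ → ℕ, StrictMono s ∧ ∃ v' : (l : Fin k) → L1 N (l + 1),
      ∀ l, Tendsto (fun j => v (s j) l) atTop (𝓝 (v' l)) := by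
  refine exists_common_subseq v fun l s hs => ?_
  obtain ⟨R', hR'⟩ := (((continuous_opNorm N (l + 1)).tendsto _).comp (h.tendsto l)).bddAbove_range
  have hsup : (⨆ j, (ENNReal.ofReal (opNorm (B (s j) l)) +
      bvNorm (B (s j) l) (v (s j) l))) < ⊤ := by
    refine (iSup_le fun j => ?_).trans_lt (show
      ENNReal.ofReal R' + (ENNReal.ofReal R + C) < ⊤ by simp [hC.lt_top])
    refine add_le_add (ENNReal.ofReal_le_ofReal (hR' ⟨s j, rfl⟩)) (add_le_add ?_ (hmass _ l))
    exact enorm_le_ofReal (hR _ l)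
  obtain ⟨-, v', t, -, ht, hlim, -⟩ := h.compactClosed l (fun j => B (s j) l) (fun j => v (s j) l)
    (fun j => ⟨s j, rfl⟩) (fun j => h.admissible _ l) (fun j => hv _ l) hsup
  exact ⟨t, ht, v', hlim⟩

/-- The auxiliary fields are bounded in `L¹` if the function and the residuals are bounded. -/
theorem exists_norm_le (h : ConvergentFamily B B') {u : ℕ → L1R N} {R : ℝ} (hu : ∀ n, ‖u n‖ ≤ R)
    {v : ℕ → (l : Fin k) → L1 N (l + 1)} {C : ℝ≥0∞} (hC : C ≠ ⊤) (hgrad : ∀ n, mass (gradResidual (u n) (v n)) ≤ C)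
    (hop : ∀ n l, mass (opResidual (B n) (v n) l) ≤ C) : ∃ M, ∀ n l, ‖v n l‖ ≤ M := by
  set r : ℕ → ℝ := fun n => ∑ l, ‖v n l‖ with hr
  have hle : ∀ n l, ‖v n l‖ ≤ r n := fun n l =>
    Finset.single_le_sum (f := fun l => ‖v n l‖) (fun _ _ => norm_nonneg _) (Finset.mem_univ l)
  by_contra hunb
  -- The bound `j + 1`, rather than `j`, makes the normalizing factors `c j` at most `1` from the
  -- start.
  have hfreq : ∀ j : ℕ, ∃ᶠ n in atTop, (j : ℝ) + 1 ≤ r n := by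
    intro j hj
    refine hunb ?_
    have hbdd : BddAbove (range r) := by
      refine IsBoundedUnder.bddAbove_range ⟨(j : ℝ) + 1, ?_⟩
      rw [eventually_map]
      exact hj.mono fun n hn => (not_le.1 hn).le
    obtain ⟨M, hM⟩ := hbdd
    exact ⟨M, fun n l => (hle n l).trans (hM ⟨n, rfl⟩)⟩
  obtain ⟨s, hs, hsr⟩ := extraction_forall_of_frequently hfreq
  set c : ℕ → ℝ := fun j => (r (s j))⁻¹ with hc
  have hrpos : ∀ j, 0 < r (s j) := fun j => lt_of_lt_of_le (by positivity) (hsr j)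
  have hcpos : ∀ j, 0 < c j := fun j => inv_pos.2 (hrpos j)
  have hc1 : ∀ j, c j ≤ 1 := fun j =>
    inv_le_one_of_one_le₀ (le_trans (by simp) (hsr j))
  have hc0 : Tendsto c atTop (𝓝 0) :=
    tendsto_inv_atTop_zero.comp (tendsto_atTop_mono hsr
      (tendsto_atTop_add_const_right _ _ tendsto_natCast_atTop_atTop))
  have hce : Tendsto (fun j => ‖c j‖ₑ * C) atTop (𝓝 0) := by
    have := ENNReal.Tendsto.mul_const (b := C) hc0.enorm (Or.inr hC)
    simpa using this
  have hce1 : ∀ j, ‖c j‖ₑ * C ≤ C := fun j => by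
    refine mul_le_of_le_one_left zero_le ?_
    rw [← ofReal_norm, Real.norm_of_nonneg (hcpos j).le]
    simpa using hc1 j
  have hwsum : ∀ j, ∑ l, ‖(c j • v (s j)) l‖ = 1 := fun j => by
    simp only [Pi.smul_apply, norm_smul, ← Finset.mul_sum, Real.norm_of_nonneg (hcpos j).le]
    exact inv_mul_cancel₀ (hrpos j).ne'
  have hwle : ∀ j l, ‖(c j • v (s j)) l‖ ≤ 1 := fun j l => by
    rw [← hwsum j]
    exact Finset.single_le_sum (f := fun l => ‖(c j • v (s j)) l‖) (fun _ _ => norm_nonneg _)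
      (Finset.mem_univ l)
  have hwop : ∀ j l, mass (opResidual (B (s j)) (c j • v (s j)) l) ≤ ‖c j‖ₑ * C := fun j l => by
    rw [opResidual_smul]
    refine (mass_const_mul_le (isLinearMap_opResidual _ _ _) _).trans ?_
    gcongr
    exact hop _ l
  have hwgrad : ∀ j, mass (gradResidual (c j • u (s j)) (c j • v (s j))) ≤ ‖c j‖ₑ * C := fun j => by
    rw [gradResidual_smul]
    refine (mass_const_mul_le (isLinearMap_gradResidual _ _) _).trans ?_
    gcongr
    exact hgrad _
  have hwmass : ∀ j l, mass (distOp (B (s j) l) ((c j • v (s j)) l)) ≤ C + ENNReal.ofReal 1 :=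
    fun j l => mass_distOp_le zero_le_one (hwle j) l ((hwop j l).trans (hce1 j))
  have hfin : C + ENNReal.ofReal 1 ≠ ⊤ := by simp [hC]
  obtain ⟨t, ht, w, hw⟩ := (h.comp hs).exists_subseq_tendsto (v := fun j => c j • v (s j))
    (fun j l => mass_lt_top_iff.1 ((hwmass j l).trans_lt hfin.lt_top)) hwle hfin hwmass
  have hcu : Tendsto (fun j => c (t j) • u (s (t j))) atTop (𝓝 0) := by
    refine squeeze_zero_norm (a := fun j => c (t j) * R) (fun j => ?_) ?_
    · rw [norm_smul, Real.norm_of_nonneg (hcpos _).le]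
      exact mul_le_mul_of_nonneg_left (hu _) (hcpos _).le
    · simpa using (hc0.comp ht.tendsto_atTop).mul_const R
  have hcet := hce.comp ht.tendsto_atTop
  -- All residuals of the normalized fields tend to `0` in mass, so semicontinuity makes those of
  -- the limit vanish.
  have hg0 : mass (gradResidual 0 w) = 0 := le_antisymm
    (mass_le_of_tendsto (fun j => isLinearMap_gradResidual _ _) (isLinearMap_gradResidual _ _)
      (tendsto_gradResidual hcu hw) (tendsto_of_tendsto_of_tendsto_of_le_of_le tendsto_const_nhds
        hcet (fun j => zero_le) fun j => hwgrad (t j))) zero_le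
  have ho0 : ∀ l, mass (opResidual B' w l) = 0 := fun l => le_antisymm
    (mass_le_of_tendsto (fun j => isLinearMap_opResidual _ _ _) (isLinearMap_opResidual _ _ _)
      (tendsto_opResidual ((h.comp hs).comp ht).tendsto hw l)
      (tendsto_of_tendsto_of_tendsto_of_le_of_le tendsto_const_nhds
        hcet (fun j => zero_le) fun j => hwop (t j) l)) zero_le
  -- The limit equations are triangular: `w_0 = D0 = 0`, and `w_l = 0` forces `w_{l+1} = 𝓑^l w_l =
  -- 0`.
  have hext : ∀ l ≤ k, extend w l = 0 := by
    intro l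
    induction l with
    | zero =>
      refine fun _ => toDist_injective fun φ => ?_
      have := eq_zero_of_mass_eq_zero (isLinearMap_gradResidual _ _) hg0 φ
      rwa [gradResidual, distGrad_zero, zero_sub, neg_eq_zero] at this
    | succ l ih =>
      refine fun hl => toDist_injective fun φ => ?_
      have h1 := eq_zero_of_mass_eq_zero (isLinearMap_opResidual _ _ _) (ho0 ⟨l, hl⟩) φ
      have h2 : w ⟨l, hl⟩ = 0 := (extend_coe w ⟨l, hl⟩).symm.trans (ih (Nat.le_of_succ_le hl))
      rwa [opResidual, h2, distOp_zero, sub_zero] at h1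
  have hw0 : ∀ l, w l = 0 := fun l => (extend_coe w l).symm.trans (hext l l.2.le)
  -- Strong convergence preserves the total norm `1`, against `w = 0`.
  have hlim : Tendsto (fun j => ∑ l, ‖(c (t j) • v (s (t j))) l‖) atTop (𝓝 (∑ l, ‖w l‖)) :=
    tendsto_finsetSum _ fun l _ => (hw l).norm
  simp only [hwsum, hw0, norm_zero, Finset.sum_const_zero] at hlim
  exact one_ne_zero (tendsto_nhds_unique tendsto_const_nhds hlim)

end ConvergentFamily

end

section

variable {N k : ℕ}

/-! ### The value of the functional at given auxiliary fields -/

/-- The sum that is minimized in the definition of `pgv`. -/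
def pgvValue (α : Fin (k + 1) → ℝ) (B : (l : Fin k) → DiffOp N (l + 1)) (u : L1R N)
    (v : (l : Fin k) → L1 N (l + 1)) : ℝ≥0∞ :=
  ENNReal.ofReal (α 0) * mass (gradResidual u v) +
    ∑ l : Fin k, ENNReal.ofReal (α l.succ) * mass (opResidual B v l)

theorem pgv_le_pgvValue {α : Fin (k + 1) → ℝ} {B : (l : Fin k) → DiffOp N (l + 1)} {u : L1R N}
    {v : (l : Fin k) → L1 N (l + 1)} (hv : ∀ l, v l ∈ BVOp (B l)) :
    pgv α B u ≤ pgvValue α B u v := iInf₂_le v hv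

/-- The fidelity term `‖u - u_η‖_{L²}`. -/
def fidelity (uη : L2R N) (u : L1R N) : ℝ≥0∞ := eLpNorm (fun x => u x - uη x) 2 (cubeVol N)

theorem energy_of_mem (uη : L2R N) (α : Fin (k + 1) → ℝ) (B : (l : Fin k) → DiffOp N (l + 1))
    {u : L1R N} (hu : u ∈ BV N) : energy uη α B u = fidelity uη u ^ 2 + pgv α B u := by
  rw [energy, if_pos hu, fidelity]

/-- The infimum in `pgv` is not known to be attained, so strict inequalities are used to obtain
almost optimal fields. -/
theorem exists_of_energy_lt {uη : L2R N} {α : Fin (k + 1) → ℝ}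
    {B : (l : Fin k) → DiffOp N (l + 1)} {u : L1R N} {C : ℝ≥0∞} (h : energy uη α B u < C) :
    ∃ v : (l : Fin k) → L1 N (l + 1), (∀ l, v l ∈ BVOp (B l)) ∧
      fidelity uη u ^ 2 + pgvValue α B u v < C := by
  by_cases hu : u ∈ BV N
  · rw [energy_of_mem uη α B hu, pgv, ENNReal.add_iInf, iInf_lt_iff] at h
    obtain ⟨v, hv⟩ := h
    by_cases hvB : ∀ l, v l ∈ BVOp (B l)
    · rw [iInf_pos hvB] at hv
      exact ⟨v, hvB, hv⟩
    · rw [iInf_neg hvB, add_top] at hv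
      exact absurd hv not_top_lt
  · rw [energy, if_neg hu] at h
    exact absurd h not_top_lt

theorem le_ofReal_mul_of_ofReal_mul_le {a M : ℝ} (ha : 0 < a) (haM : a⁻¹ ≤ M) {x C : ℝ≥0∞}
    (h : ENNReal.ofReal a * x ≤ C) : x ≤ ENNReal.ofReal M * C := by
  calc x = ENNReal.ofReal a⁻¹ * (ENNReal.ofReal a * x) := by
        rw [← mul_assoc, ← ENNReal.ofReal_mul (inv_nonneg.2 ha.le), inv_mul_cancel₀ ha.ne',
          ENNReal.ofReal_one, one_mul]
    _ ≤ _ := by gcongr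

theorem mass_gradResidual_le {α : Fin (k + 1) → ℝ} {B : (l : Fin k) → DiffOp N (l + 1)}
    {u : L1R N} {v : (l : Fin k) → L1 N (l + 1)} {M : ℝ} (hα : ∀ i, 0 < α i)
    (hM : ∀ i, (α i)⁻¹ ≤ M) {C : ℝ≥0∞} (h : pgvValue α B u v ≤ C) :
    mass (gradResidual u v) ≤ ENNReal.ofReal M * C :=
  le_ofReal_mul_of_ofReal_mul_le (hα 0) (hM 0) (le_self_add.trans h)

theorem mass_opResidual_le {α : Fin (k + 1) → ℝ} {B : (l : Fin k) → DiffOp N (l + 1)}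
    {u : L1R N} {v : (l : Fin k) → L1 N (l + 1)} {M : ℝ} (hα : ∀ i, 0 < α i)
    (hM : ∀ i, (α i)⁻¹ ≤ M) {C : ℝ≥0∞} (h : pgvValue α B u v ≤ C) (l : Fin k) :
    mass (opResidual B v l) ≤ ENNReal.ofReal M * C := by
  refine le_ofReal_mul_of_ofReal_mul_le (hα l.succ) (hM l.succ) (le_trans ?_ (le_add_self.trans h))
  exact Finset.single_le_sum
    (f := fun l : Fin k => ENNReal.ofReal (α l.succ) * mass (opResidual B v l))
    (fun _ _ => zero_le) (Finset.mem_univ l)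

theorem exists_inv_le {α : ℕ → Fin (k + 1) → ℝ} {α' : Fin (k + 1) → ℝ} (hα : ∀ n i, 0 < α n i)
    (hα' : ∀ i, 0 < α' i) (hlim : Tendsto α atTop (𝓝 α')) : ∃ M, ∀ n i, (α n i)⁻¹ ≤ M := by
  have h : Tendsto (fun n => ∑ i, (α n i)⁻¹) atTop (𝓝 (∑ i, (α' i)⁻¹)) :=
    tendsto_finsetSum _ fun i _ => (tendsto_pi_nhds.1 hlim i).inv₀ (hα' i).ne'
  obtain ⟨M, hM⟩ := h.bddAbove_range
  refine ⟨M, fun n i => le_trans ?_ (hM ⟨n, rfl⟩)⟩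
  exact Finset.single_le_sum (f := fun i => (α n i)⁻¹) (fun i _ => (inv_pos.2 (hα n i)).le)
    (Finset.mem_univ i)

/-- Fatou's lemma along a subsequence converging almost everywhere; the limit `L` is the same along
it. -/
theorem fidelity_le_of_tendsto (uη : L2R N) {u : ℕ → L1R N} {u' : L1R N}
    (hu : Tendsto u atTop (𝓝 u')) {L : ℝ≥0∞}
    (hL : Tendsto (fun n => fidelity uη (u n)) atTop (𝓝 L)) : fidelity uη u' ≤ L := by
  obtain ⟨s, hs, hae⟩ := (tendstoInMeasure_of_tendsto_Lp hu).exists_seq_tendsto_ae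
  have h := Lp.eLpNorm_lim_le_liminf_eLpNorm (p := 2) (μ := cubeVol N)
    (f := fun j x => u (s j) x - uη x)
    (fun j => ((Lp.aestronglyMeasurable _).sub (Lp.aestronglyMeasurable _)))
    (fun x => u' x - uη x) (hae.mono fun x hx => hx.sub_const _)
  exact h.trans_eq (hL.comp hs.tendsto_atTop).liminf_eq

/-- `Q` has finite measure, so the `L²` norm controls the `L¹` norm. -/
theorem exists_norm_le_of_fidelity_le (uη : L2R N) {C : ℝ≥0∞} (hC : C ≠ ⊤) :
    ∃ R : ℝ, ∀ u : L1R N, fidelity uη u ≤ C → ‖u‖ ≤ R := by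
  set K : ℝ≥0∞ := cubeVol N univ ^ (1 / (1 : ℝ≥0∞).toReal - 1 / (2 : ℝ≥0∞).toReal)
  have hK : K ≠ ⊤ := ENNReal.rpow_ne_top_of_nonneg (by norm_num) (measure_ne_top _ _)
  have hη : eLpNorm uη 2 (cubeVol N) ≠ ⊤ := Lp.eLpNorm_ne_top uη
  have hfin : C * K + eLpNorm uη 2 (cubeVol N) * K ≠ ⊤ :=
    ENNReal.add_ne_top.2 ⟨ENNReal.mul_ne_top hC hK, ENNReal.mul_ne_top hη hK⟩
  refine ⟨(C * K + eLpNorm uη 2 (cubeVol N) * K).toReal, fun u hu => ?_⟩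
  rw [Lp.norm_def]
  refine ENNReal.toReal_mono hfin ?_
  have hmu := Lp.aestronglyMeasurable u
  have hmη := Lp.aestronglyMeasurable uη
  calc eLpNorm u 1 (cubeVol N)
      = eLpNorm ((fun x => u x - uη x) + fun x => uη x) 1 (cubeVol N) := by
        congr 1
        ext x
        simp
    _ ≤ eLpNorm (fun x => u x - uη x) 1 (cubeVol N) + eLpNorm uη 1 (cubeVol N) :=
        eLpNorm_add_le (hmu.sub hmη) hmη le_rfl
    _ ≤ fidelity uη u * K + eLpNorm uη 2 (cubeVol N) * K :=
        add_le_add (eLpNorm_le_eLpNorm_mul_rpow_measure_univ (by norm_num) (hmu.sub hmη))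
          (eLpNorm_le_eLpNorm_mul_rpow_measure_univ (by norm_num) hmη)
    _ ≤ _ := by gcongr

theorem le_add_one_of_sq_le {x C : ℝ≥0∞} (h : x ^ 2 ≤ C) : x ≤ C + 1 := by
  rcases le_total x 1 with hx | hx
  · exact hx.trans le_add_self
  · refine le_trans ?_ (h.trans le_self_add)
    rw [sq]
    exact le_mul_of_one_le_left zero_le hx

/-! ### Lower semicontinuity and compactness for the energies. -/

namespace ConvergentFamily

variable {B : ℕ → (l : Fin k) → DiffOp N (l + 1)} {B' : (l : Fin k) → DiffOp N (l + 1)}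
  {α : ℕ → Fin (k + 1) → ℝ} {α' : Fin (k + 1) → ℝ}

theorem exists_mass_distGrad_le (h : ConvergentFamily B B') (hα : ∀ n i, 0 < α n i) {M : ℝ}
    (hM : ∀ n i, (α n i)⁻¹ ≤ M) {u : ℕ → L1R N} {R : ℝ} (hu : ∀ n, ‖u n‖ ≤ R)
    {v : ℕ → (l : Fin k) → L1 N (l + 1)} {C : ℝ≥0∞} (hC : C ≠ ⊤)
    (hval : ∀ n, pgvValue (α n) (B n) (u n) (v n) ≤ C) :
    ∃ R' : ℝ, (∀ n l, ‖v n l‖ ≤ R') ∧ ∃ C' : ℝ≥0∞, C' ≠ ⊤ ∧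
      (∀ n, mass (distGrad (u n)) ≤ C') ∧ ∀ n l, mass (distOp (B n l) (v n l)) ≤ C' := by
  have hfin : ENNReal.ofReal M * C ≠ ⊤ := ENNReal.mul_ne_top (by simp) hC
  have hgrad := fun n => mass_gradResidual_le (hα n) (hM n) (hval n)
  have hop := fun n => mass_opResidual_le (hα n) (hM n) (hval n)
  obtain ⟨R', hR'⟩ := h.exists_norm_le hu hfin hgrad hop
  have hR'0 : ∀ n l, ‖v n l‖ ≤ max R' 0 := fun n l => (hR' n l).trans (le_max_left _ _)
  exact ⟨max R' 0, hR'0, ENNReal.ofReal M * C + ENNReal.ofReal (max R' 0),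
    ENNReal.add_ne_top.2 ⟨hfin, by simp⟩,
    fun n => mass_distGrad_le (le_max_right _ _) (hR'0 n) (hgrad n),
    fun n l => mass_distOp_le (le_max_right _ _) (hR'0 n) l (hop n l)⟩

/-- Lower semicontinuity of the energies along a sequence with bounded energies. -/
theorem energy_le_of_forall_lt (h : ConvergentFamily B B') (hα : ∀ n i, 0 < α n i)
    (hα' : ∀ i, 0 < α' i) (hαlim : Tendsto α atTop (𝓝 α')) (uη : L2R N) {u : ℕ → L1R N}
    {u' : L1R N} (hu : Tendsto u atTop (𝓝 u')) {C : ℝ≥0∞} (hC : C ≠ ⊤)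
    (hen : ∀ n, energy uη (α n) (B n) (u n) < C) : energy uη α' B' u' ≤ C := by
  obtain ⟨M, hM⟩ := exists_inv_le hα hα' hαlim
  obtain ⟨R, hR⟩ := hu.norm.bddAbove_range
  choose v hv hval using fun n => exists_of_energy_lt (hen n)
  obtain ⟨R', hR', C', hC', hDu, hBv⟩ := h.exists_mass_distGrad_le hα hM
    (fun n => hR ⟨n, rfl⟩) hC fun n => le_add_self.trans (hval n).le
  obtain ⟨s, hs, v', hv'⟩ := h.exists_subseq_tendsto hv hR' hC' hBv
  -- `[0, ∞]` is compact, so one further extraction makes every term of the energy converge,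
  -- possibly to `⊤`.
  obtain ⟨⟨a, b, L⟩, t, ht, hlim⟩ := CompactSpace.tendsto_subseq
    (fun j => (⟨fidelity uη (u (s j)), mass (gradResidual (u (s j)) (v (s j))),
      fun l => mass (opResidual (B (s j)) (v (s j)) l)⟩ : ℝ≥0∞ × ℝ≥0∞ × (Fin k → ℝ≥0∞)))
  have hst := hs.comp ht
  have ha : Tendsto (fun j => fidelity uη (u (s (t j)))) atTop (𝓝 a) := hlim.fst_nhds
  have hb : Tendsto (fun j => mass (gradResidual (u (s (t j))) (v (s (t j))))) atTop (𝓝 b) :=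
    hlim.snd_nhds.fst_nhds
  have hL : ∀ l, Tendsto (fun j => mass (opResidual (B (s (t j))) (v (s (t j))) l)) atTop
      (𝓝 (L l)) := tendsto_pi_nhds.1 hlim.snd_nhds.snd_nhds
  have hu2 : Tendsto (fun j => u (s (t j))) atTop (𝓝 u') := hu.comp hst.tendsto_atTop
  have hv2 : ∀ l, Tendsto (fun j => v (s (t j)) l) atTop (𝓝 (v' l)) := fun l =>
    (hv' l).comp ht.tendsto_atTop
  have hB2 := (h.comp hst).tendsto
  have hα2 : ∀ i, Tendsto (fun j => ENNReal.ofReal (α (s (t j)) i)) atTop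
      (𝓝 (ENNReal.ofReal (α' i))) := fun i =>
    ENNReal.tendsto_ofReal ((tendsto_pi_nhds.1 hαlim i).comp hst.tendsto_atTop)
  -- A nonzero finite limit of the weights lets the products converge even if the masses tend to `⊤`
  -- or to `0`.
  have hα0 : ∀ i, ENNReal.ofReal (α' i) ≠ 0 := fun i => (ENNReal.ofReal_pos.2 (hα' i)).ne'
  have hle : a ^ 2 + (ENNReal.ofReal (α' 0) * b +
      ∑ l : Fin k, ENNReal.ofReal (α' l.succ) * L l) ≤ C := by
    refine le_of_tendsto' ((ENNReal.Tendsto.pow ha).add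
      ((ENNReal.Tendsto.mul (hα2 0) (Or.inl (hα0 0)) hb (Or.inr ENNReal.ofReal_ne_top)).add
      (tendsto_finsetSum _ fun l _ => ENNReal.Tendsto.mul (hα2 l.succ) (Or.inl (hα0 _)) (hL l)
        (Or.inr ENNReal.ofReal_ne_top)))) fun j => (hval (s (t j))).le
  have huBV : u' ∈ BV N := mass_lt_top_iff.1 ((mass_le_of_tendsto_of_le
    (fun n => isLinearMap_distGrad (u n)) (isLinearMap_distGrad u') (tendsto_distGrad hu)
    hDu).trans_lt hC'.lt_top)
  have hvBV : ∀ l, v' l ∈ BVOp (B' l) := fun l => mass_lt_top_iff.1 ((mass_le_of_tendsto_of_le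
    (fun j => isLinearMap_distOp (B (s (t j)) l) (v (s (t j)) l)) (isLinearMap_distOp _ _)
    (tendsto_distOp (hB2 l) (hv2 l)) fun j => hBv _ l).trans_lt hC'.lt_top)
  rw [energy_of_mem uη α' B' huBV]
  refine le_trans ?_ hle
  refine add_le_add (pow_le_pow_left' (fidelity_le_of_tendsto uη hu2 ha) 2)
    ((pgv_le_pgvValue hvBV).trans (add_le_add ?_ (Finset.sum_le_sum fun l _ => ?_)))
  · gcongr
    exact mass_le_of_tendsto (fun j => isLinearMap_gradResidual _ _)
      (isLinearMap_gradResidual _ _) (tendsto_gradResidual hu2 hv2) hb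
  · gcongr
    exact mass_le_of_tendsto (fun j => isLinearMap_opResidual _ _ _)
      (isLinearMap_opResidual _ _ _) (tendsto_opResidual hB2 hv2 l) (hL l)

/-- Above the liminf, a finite level `C'` bounds the energies along a subsequence, where the bounded
case applies. -/
theorem energy_le_liminf (h : ConvergentFamily B B') (hα : ∀ n i, 0 < α n i)
    (hα' : ∀ i, 0 < α' i) (hαlim : Tendsto α atTop (𝓝 α')) (uη : L2R N) {u : ℕ → L1R N}
    {u' : L1R N} (hu : Tendsto u atTop (𝓝 u')) :
    energy uη α' B' u' ≤ liminf (fun n => energy uη (α n) (B n) (u n)) atTop := by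
  refine le_of_forall_gt fun C hC => ?_
  obtain ⟨C', hC', hCC'⟩ := exists_between hC
  obtain ⟨s, hs, hlt⟩ := extraction_of_frequently_atTop
    (frequently_lt_of_liminf_lt (by isBoundedDefault) hC')
  exact ((h.comp hs).energy_le_of_forall_lt (fun n => hα (s n)) hα'
    (hαlim.comp hs.tendsto_atTop) uη (hu.comp hs.tendsto_atTop) (hCC'.trans_le le_top).ne
    hlt).trans_lt hCC'

/-- Sequences with bounded energies are compact in `BV(Q)`. -/
theorem exists_bvWeakStar (h : ConvergentFamily B B') (hk : 1 ≤ k) (hN : 1 ≤ N)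
    (hα : ∀ n i, 0 < α n i) (hα' : ∀ i, 0 < α' i) (hαlim : Tendsto α atTop (𝓝 α')) (uη : L2R N)
    {u : ℕ → L1R N} (hen : (⨆ n, energy uη (α n) (B n) (u n)) < ⊤) :
    ∃ u' ∈ BV N, ∃ s : ℕ → ℕ, StrictMono s ∧ BVWeakStar (fun j => u (s j)) u' := by
  obtain ⟨C, hCen, hC⟩ := exists_between hen
  obtain ⟨M, hM⟩ := exists_inv_le hα hα' hαlim
  choose v hv hval using fun n => exists_of_energy_lt (C := C) ((le_iSup (fun n => energy uη (α n) (B n) (u n)) n).trans_lt hCen)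
  obtain ⟨R, hR⟩ := exists_norm_le_of_fidelity_le uη (C := C + 1) (by simp [hC.ne])
  have hu : ∀ n, ‖u n‖ ≤ R := fun n =>
    hR _ (le_add_one_of_sq_le (le_self_add.trans (hval n).le))
  obtain ⟨-, -, C', hC', hDu, -⟩ := h.exists_mass_distGrad_le hα hM hu hC.ne
    fun n => le_add_self.trans (hval n).le
  -- `k ≥ 1` supplies an operator and `N ≥ 1` a component in which to place `u`; any choice would
  -- do.
  obtain ⟨u', s, hs, hlim⟩ := (h.admissible 0 ⟨0, hk⟩).exists_subseq_tendsto
    (fun _ => ⟨0, hN⟩) hu hC' hDu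
  refine ⟨u', mass_lt_top_iff.1 ((mass_le_of_tendsto_of_le (fun j => isLinearMap_distGrad _)
    (isLinearMap_distGrad u') (tendsto_distGrad hlim) fun j => hDu (s j)).trans_lt hC'.lt_top),
    s, hs, hlim, measWeakStar_of_tendsto (fun j => isLinearMap_distGrad _)
    (isLinearMap_distGrad u') (tendsto_distGrad hlim) hC' fun j => hDu (s j)⟩

end ConvergentFamily

end

section

open scoped Convolution

variable {N m l : ℕ}

/-! ### Mollification after a dilation -/

/-- A bump function whose support is so small that `Q` plus this support is contained in
`(1 + ε) Q`. -/
def bump (N : ℕ) (ε : ℝ) (hε : 0 < ε) : ContDiffBump (0 : EuclideanSpace ℝ (Fin N)) :=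
  ⟨ε / 8, ε / 4, by positivity, by linarith⟩

/-- The mollifier of integral one on the scale `ε`. -/
def mollifier (N : ℕ) (ε : ℝ) (hε : 0 < ε) : EuclideanSpace ℝ (Fin N) → ℝ :=
  (bump N ε hε).normed volume

section mollify

variable {F : Type*} [NormedAddCommGroup F] [NormedSpace ℝ F] {ε : ℝ} (hε : 0 < ε)

theorem mollifier_nonneg (x : EuclideanSpace ℝ (Fin N)) : 0 ≤ mollifier N ε hε x :=
  (bump N ε hε).nonneg_normed x

theorem mollifier_neg (x : EuclideanSpace ℝ (Fin N)) :
    mollifier N ε hε (-x) = mollifier N ε hε x := (bump N ε hε).normed_neg x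

theorem contDiff_mollifier {n : ℕ∞} : ContDiff ℝ n (mollifier N ε hε) :=
  (bump N ε hε).contDiff_normed

theorem hasCompactSupport_mollifier : HasCompactSupport (mollifier N ε hε) :=
  (bump N ε hε).hasCompactSupport_normed

theorem continuous_mollifier : Continuous (mollifier N ε hε) :=
  (contDiff_mollifier hε (n := 0)).continuous

theorem integrable_mollifier : Integrable (mollifier N ε hε) volume :=
  (bump N ε hε).integrable_normed

theorem integral_mollifier : ∫ x, mollifier N ε hε x = 1 := (bump N ε hε).integral_normed

/-- The convolution with the mollifier. -/
def mollify (f : EuclideanSpace ℝ (Fin N) → F) : EuclideanSpace ℝ (Fin N) → F :=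
  mollifier N ε hε ⋆[ContinuousLinearMap.lsmul ℝ ℝ, volume] f

theorem convolutionExists_mollifier {f : EuclideanSpace ℝ (Fin N) → F}
    (hf : LocallyIntegrable f volume) :
    ConvolutionExists (mollifier N ε hε) f (ContinuousLinearMap.lsmul ℝ ℝ) volume :=
  (hasCompactSupport_mollifier hε).convolutionExists_left _ (continuous_mollifier hε) hf

theorem integrable_mollify {f : EuclideanSpace ℝ (Fin N) → F} (hf : Integrable f volume) :
    Integrable (mollify hε f) volume :=
  (integrable_mollifier hε).integrable_convolution _ hf

theorem mollify_apply (f : EuclideanSpace ℝ (Fin N) → F) (x : EuclideanSpace ℝ (Fin N)) :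
    mollify hε f x = ∫ y, mollifier N ε hε y • f (x - y) := rfl

theorem mollify_apply_swap (f : EuclideanSpace ℝ (Fin N) → F) (x : EuclideanSpace ℝ (Fin N)) :
    mollify hε f x = ∫ y, mollifier N ε hε (x - y) • f y := convolution_lsmul_swap

theorem norm_mollify_le {f : EuclideanSpace ℝ (Fin N) → F} {C : ℝ} (hC : ∀ x, ‖f x‖ ≤ C)
    (x : EuclideanSpace ℝ (Fin N)) : ‖mollify hε f x‖ ≤ C := by
  calc ‖mollify hε f x‖ ≤ ∫ y, mollifier N ε hε y * C := by
        rw [mollify_apply]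
        refine norm_integral_le_of_norm_le ((integrable_mollifier hε).mul_const C)
          (Eventually.of_forall fun y => ?_)
        rw [norm_smul, Real.norm_of_nonneg (mollifier_nonneg hε y)]
        exact mul_le_mul_of_nonneg_left (hC _) (mollifier_nonneg hε y)
    _ = C := by rw [integral_mul_const, integral_mollifier, one_mul]

theorem integral_norm_mollify_le [CompleteSpace F] {f : EuclideanSpace ℝ (Fin N) → F}
    (hf : Integrable f volume) : ∫ x, ‖mollify hε f x‖ ≤ ∫ x, ‖f x‖ := by
  calc ∫ x, ‖mollify hε f x‖ ≤ ∫ x, mollify hε (fun y => ‖f y‖) x := by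
        refine integral_mono (integrable_mollify hε hf).norm (integrable_mollify hε hf.norm)
          fun x => ?_
        rw [mollify_apply, mollify_apply]
        refine (norm_integral_le_integral_norm _).trans_eq (integral_congr_ae ?_)
        refine Eventually.of_forall fun y => ?_
        simp only [norm_smul, Real.norm_of_nonneg (mollifier_nonneg hε y), smul_eq_mul]
    _ = ∫ x, ‖f x‖ := by
        have := integral_convolution (μ := volume) (ν := volume)
          (ContinuousLinearMap.lsmul ℝ ℝ (E := ℝ)) (integrable_mollifier (N := N) hε) hf.norm
        rw [integral_mollifier] at this
        simpa [mollify] using this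

theorem mollify_sub {f g : EuclideanSpace ℝ (Fin N) → F} (hf : LocallyIntegrable f volume)
    (hg : LocallyIntegrable g volume) (x : EuclideanSpace ℝ (Fin N)) :
    mollify hε (fun y => f y - g y) x = mollify hε f x - mollify hε g x := by
  simp only [mollify_apply, smul_sub]
  exact integral_sub (convolutionExists_mollifier hε hf x) (convolutionExists_mollifier hε hg x)

theorem mollify_comp_clm [CompleteSpace F] {G : Type*} [NormedAddCommGroup G] [NormedSpace ℝ G]
    [CompleteSpace G] (L : F →L[ℝ] G) {f : EuclideanSpace ℝ (Fin N) → F}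
    (hf : LocallyIntegrable f volume) (x : EuclideanSpace ℝ (Fin N)) :
    mollify hε (fun y => L (f y)) x = L (mollify hε f x) := by
  rw [mollify_apply, mollify_apply]
  simpa using L.integral_comp_comm (convolutionExists_mollifier hε hf x)

/-- Convolution with the mollifier is self-adjoint. -/
theorem integral_mollify_mul {f g : EuclideanSpace ℝ (Fin N) → ℝ} (hf : Integrable f volume)
    (hg : Integrable g volume) : ∫ x, mollify hε f x * g x = ∫ x, f x * mollify hε g x := by
  have hint : Integrable (Function.uncurry fun x y => mollifier N ε hε (x - y) * (g x * f y))
      (volume.prod volume) := by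
    obtain ⟨C, hC⟩ := (continuous_mollifier (N := N) hε).bounded_above_of_compact_support
      (hasCompactSupport_mollifier hε)
    refine (hg.mul_prod hf).bdd_mul (c := C) ?_ (Eventually.of_forall fun z => hC _)
    exact ((continuous_mollifier hε).comp (continuous_fst.sub continuous_snd)).aestronglyMeasurable
  calc ∫ x, mollify hε f x * g x
      = ∫ x, ∫ y, mollifier N ε hε (x - y) * (g x * f y) := by
        refine integral_congr_ae (Eventually.of_forall fun x => ?_)
        simp only [mollify_apply_swap, smul_eq_mul]
        rw [← integral_mul_const]
        refine integral_congr_ae (Eventually.of_forall fun y => ?_)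
        ring
    _ = ∫ y, ∫ x, mollifier N ε hε (x - y) * (g x * f y) := integral_integral_swap hint
    _ = _ := by
        refine integral_congr_ae (Eventually.of_forall fun y => ?_)
        simp only [mollify_apply_swap, smul_eq_mul]
        rw [← integral_const_mul]
        refine integral_congr_ae (Eventually.of_forall fun x => ?_)
        simp only
        -- Self-adjointness comes from the evenness of the kernel.
        rw [← mollifier_neg, neg_sub]
        ring

theorem contDiff_mollify {f : EuclideanSpace ℝ (Fin N) → F} (hf : LocallyIntegrable f volume)
    {n : ℕ∞} : ContDiff ℝ n (mollify hε f) :=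
  (hasCompactSupport_mollifier hε).contDiff_convolution_left _ (contDiff_mollifier hε) hf

/-- The derivative of a mollification, in terms of the derivative of the function. -/
theorem fderiv_mollify_apply [CompleteSpace F] {f : EuclideanSpace ℝ (Fin N) → F}
    (hf : ContDiff ℝ 1 f) (hs : HasCompactSupport f) (x e : EuclideanSpace ℝ (Fin N)) :
    fderiv ℝ (mollify hε f) x e = mollify hε (fun y => fderiv ℝ f y e) x := by
  have h := hs.hasFDerivAt_convolution_right (ContinuousLinearMap.lsmul ℝ ℝ)
    ((continuous_mollifier (N := N) hε).locallyIntegrable (μ := volume)) hf x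
  rw [mollify, h.fderiv]
  exact convolution_precompR_apply _ (continuous_mollifier hε).locallyIntegrable
    (hs.fderiv ℝ) (hf.continuous_fderiv one_ne_zero) x e

/-- The derivative of a mollification is controlled by the supremum of the function. -/
theorem exists_norm_fderiv_mollify_le (N : ℕ) (F : Type*) [NormedAddCommGroup F]
    [NormedSpace ℝ F] : ∃ K : ℝ, 0 ≤ K ∧ ∀ (f : EuclideanSpace ℝ (Fin N) → F), Continuous f →
      ∀ C : ℝ, (∀ x, ‖f x‖ ≤ C) → ∀ x, ‖fderiv ℝ (mollify hε f) x‖ ≤ K * C := by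
  have hint : Integrable (fderiv ℝ (mollifier N ε hε)) volume :=
    ((contDiff_mollifier hε (n := 1)).continuous_fderiv one_ne_zero).integrable_of_hasCompactSupport
      ((hasCompactSupport_mollifier hε).fderiv ℝ)
  -- The derivative is put on the kernel; the constant is the `L¹` norm of its derivative and
  -- depends on `ε` but not on `f`.
  refine ⟨∫ y, ‖fderiv ℝ (mollifier N ε hε) y‖, integral_nonneg fun _ => norm_nonneg _,
    fun f hf C hC x => ?_⟩
  have h := (hasCompactSupport_mollifier hε).hasFDerivAt_convolution_left
    (ContinuousLinearMap.lsmul ℝ ℝ (E := F)) (contDiff_mollifier (N := N) hε (n := 1))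
    (hf.locallyIntegrable (μ := volume)) x
  rw [mollify, h.fderiv, ← integral_mul_const]
  refine norm_integral_le_of_norm_le (hint.norm.mul_const _) (Eventually.of_forall fun y => ?_)
  have hC0 : 0 ≤ C := (norm_nonneg _).trans (hC 0)
  refine ContinuousLinearMap.opNorm_le_bound _ (by positivity) fun e => ?_
  calc ‖fderiv ℝ (mollifier N ε hε) y e • f (x - y)‖
      ≤ (‖fderiv ℝ (mollifier N ε hε) y‖ * ‖e‖) * C := by
        rw [norm_smul]
        exact mul_le_mul (ContinuousLinearMap.le_opNorm _ _) (hC _) (norm_nonneg _)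
          (by positivity)
    _ = _ := by ring

end mollify

end

section

open scoped Convolution Pointwise

variable {N m l : ℕ} {ε : ℝ} (hε : 0 < ε)

/-! ### Regularization of test functions and of `L¹` functions -/

/-- Coordinates of `b + y` are below `1/2 + ε/4 < (1 + ε)/2` in absolute value. This keeps
regularized test functions supported in `Q`. -/
theorem inv_smul_add_mem_cube {b y : EuclideanSpace ℝ (Fin N)} (hε : 0 < ε)
    (hb : ‖b‖ ≤ ε / 4) (hy : y ∈ cube N) : (1 + ε)⁻¹ • (b + y) ∈ cube N := by
  intro i
  have h1 : |b i| ≤ ε / 4 := by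
    simpa using (PiLp.norm_apply_le b i).trans hb
  have h2 := hy i
  have h3 : 0 < 1 + ε := by linarith
  have h4 := abs_le.1 h1
  change (1 + ε)⁻¹ * (b i + y i) ∈ _
  rw [inv_mul_eq_div, mem_Ioo, lt_div_iff₀ h3, div_lt_iff₀ h3]
  constructor <;> nlinarith [h2.1, h2.2, h4.1, h4.2]

theorem support_mollify_smul_subset {F : Type*} [NormedAddCommGroup F] [NormedSpace ℝ F]
    (f : EuclideanSpace ℝ (Fin N) → F) :
    Function.support (fun z => (1 + ε) ^ N • mollify hε f ((1 + ε) • z)) ⊆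
      (fun z => (1 + ε)⁻¹ • z) ''
        (Metric.closedBall (0 : EuclideanSpace ℝ (Fin N)) (ε / 4) + tsupport f) := by
  intro z hz
  have h1 : (1 + ε) • z ∈ Function.support (mollify hε f) := fun h => hz (by simp [h])
  refine ⟨(1 + ε) • z, ?_, inv_smul_smul₀ (by positivity) z⟩
  refine add_subset_add ?_ (subset_tsupport _) (support_convolution_subset _ h1)
  rw [mollifier, ContDiffBump.support_normed_eq]
  exact Metric.ball_subset_closedBall

theorem isCompact_image_closedBall_add {K : Set (EuclideanSpace ℝ (Fin N))} (hK : IsCompact K)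
    (ε : ℝ) : IsCompact ((fun z => (1 + ε)⁻¹ • z) ''
      (Metric.closedBall (0 : EuclideanSpace ℝ (Fin N)) (ε / 4) + K)) :=
  ((isCompact_closedBall _ _).add hK).image (continuous_const_smul _)

/-- The regularization `z ↦ (1 + ε)^N (ρ_ε ⋆ φ)((1 + ε) z)` of a test function. -/
def Test.regularize (φ : Test N m) : Test N m where
  toFun z := (1 + ε) ^ N • mollify hε φ ((1 + ε) • z)
  contDiff' := ((contDiff_mollify hε φ.continuous.locallyIntegrable).comp
    (contDiff_id.const_smul _)).const_smul _
  hasCompactSupport' := HasCompactSupport.of_support_subset_isCompact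
    (isCompact_image_closedBall_add φ.hasCompactSupport ε) (support_mollify_smul_subset hε φ)
  tsupport_subset' := by
    refine (closure_minimal (support_mollify_smul_subset hε φ)
      (isCompact_image_closedBall_add φ.hasCompactSupport ε).isClosed).trans ?_
    rintro _ ⟨_, ⟨b, hb, y, hy, rfl⟩, rfl⟩
    exact inv_smul_add_mem_cube hε (mem_closedBall_zero_iff.1 hb) (φ.tsupport_subset hy)

theorem Test.regularize_apply (φ : Test N m) (z : EuclideanSpace ℝ (Fin N)) :
    φ.regularize hε z = (1 + ε) ^ N • mollify hε φ ((1 + ε) • z) := rfl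

theorem Test.norm_toC0_regularize_le (φ : Test N m) :
    ‖(φ.regularize hε).toC0‖ ≤ (1 + ε) ^ N * ‖φ.toC0‖ := by
  refine C0.norm_le (by positivity) fun x => ?_
  rw [Test.toC0_apply, Test.regularize_apply, norm_smul, Real.norm_of_nonneg (by positivity)]
  gcongr
  exact norm_mollify_le hε φ.norm_apply_le _

theorem Test.pderiv_regularize (φ : Test N m) (i : Fin N) (z : EuclideanSpace ℝ (Fin N)) :
    pderiv i (φ.regularize hε) z = (1 + ε) ^ N • (1 + ε) •
      fderiv ℝ (mollify hε φ) ((1 + ε) • z) (EuclideanSpace.single i 1) := by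
  have h1 : DifferentiableAt ℝ (mollify hε φ) ((1 + ε) • z) :=
    (contDiff_mollify hε φ.continuous.locallyIntegrable (n := 1)).differentiable one_ne_zero _
  have h2 := (h1.hasFDerivAt.comp z ((hasFDerivAt_id z).const_smul (1 + ε))).const_smul
    ((1 + ε) ^ N)
  have h3 : fderiv ℝ (φ.regularize hε) z = _ := h2.fderiv
  rw [pderiv, h3]
  simp

/-- Mollification commutes with derivatives; the dilation contributes the factor `1 + ε` by the
chain rule. -/
theorem Test.partialDeriv_regularize (φ : Test N m) (i : Fin N) :
    Test.partialDeriv N m i (φ.regularize hε) =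
      (1 + ε) • (Test.partialDeriv N m i φ).regularize hε := by
  ext1 z
  have h : (fun y => fderiv ℝ φ y (EuclideanSpace.single i 1)) = Test.partialDeriv N m i φ := by
    ext1 y
    rw [Test.partialDeriv_apply, pderiv]
  rw [Test.partialDeriv_apply, Test.pderiv_regularize, fderiv_mollify_apply hε
    (φ.contDiff.of_le (by simp)) φ.hasCompactSupport, h]
  change _ = (1 + ε) • (Test.partialDeriv N m i φ).regularize hε z
  rw [Test.regularize_apply, smul_comm]

/-- Only the sup norm of `φ` enters. By duality, every operator sends a regularized `L¹` field to a
bounded measure. -/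
theorem Test.exists_norm_pderiv_regularize_le (N m : ℕ) : ∃ K : ℝ, 0 ≤ K ∧
    ∀ (φ : Test N m) (i : Fin N) (z : EuclideanSpace ℝ (Fin N)),
      ‖pderiv i (φ.regularize hε) z‖ ≤ K * ‖φ.toC0‖ := by
  obtain ⟨K, hK0, hK⟩ := exists_norm_fderiv_mollify_le hε N (Tensor N m)
  refine ⟨(1 + ε) ^ N * ((1 + ε) * K), by positivity, fun φ i z => ?_⟩
  rw [Test.pderiv_regularize, norm_smul, norm_smul, Real.norm_of_nonneg (by positivity),
    Real.norm_of_nonneg (by positivity), mul_assoc, mul_assoc]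
  gcongr
  refine (ContinuousLinearMap.le_of_opNorm_le _ (hK φ φ.continuous _ φ.norm_apply_le _) _).trans ?_
  simp

theorem integrable_restrict_cube {F : Type*} [NormedAddCommGroup F]
    {f : EuclideanSpace ℝ (Fin N) → F} (hf : Integrable f volume) :
    Integrable (fun x : cube N => f x) (cubeVol N) := by
  refine ((measurableEmbedding_cube N).integrable_map_iff).1 ?_
  rw [map_cubeVol]
  exact hf.integrableOn

/-- The dilation `x ↦ f ((1 + ε)⁻¹ x)`. -/
def dilate {F : Type*} (ε : ℝ) (f : EuclideanSpace ℝ (Fin N) → F) :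
    EuclideanSpace ℝ (Fin N) → F := fun x => f ((1 + ε)⁻¹ • x)

theorem integrable_dilate {F : Type*} [NormedAddCommGroup F] (hε : 0 < ε)
    {f : EuclideanSpace ℝ (Fin N) → F} (hf : Integrable f volume) :
    Integrable (dilate ε f) volume :=
  hf.comp_smul (by positivity)

theorem integral_dilate {F : Type*} [NormedAddCommGroup F] [NormedSpace ℝ F] (hε : 0 < ε)
    (f : EuclideanSpace ℝ (Fin N) → F) : ∫ x, dilate ε f x = (1 + ε) ^ N • ∫ x, f x := by
  have h := Measure.integral_comp_inv_smul_of_nonneg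
    (volume : Measure (EuclideanSpace ℝ (Fin N))) f (R := 1 + ε) (by positivity)
  rwa [finrank_euclideanSpace_fin] at h

theorem integrable_zeroExt_coeFn (v : L1 N m) : Integrable (zeroExt v) volume :=
  integrable_zeroExt (L1.integrable_coeFn v)

/-- The regularization `ρ_ε ⋆ v((1 + ε)⁻¹ ·)` of an `L¹` function, restricted to the cube. -/
def regularize (v : L1 N m) : L1 N m :=
  (integrable_restrict_cube (integrable_mollify hε
    (integrable_dilate hε (integrable_zeroExt_coeFn v)))).toL1
      fun x : cube N => mollify hε (dilate ε (zeroExt v)) x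

theorem coeFn_regularize (v : L1 N m) :
    regularize hε v =ᵐ[cubeVol N] fun x : cube N => mollify hε (dilate ε (zeroExt v)) x :=
  Integrable.coeFn_toL1 _

/-- The two regularizations are transposes of each other: mollification is self-adjoint, and
substituting `x = (1 + ε) z` yields the Jacobian `(1 + ε)^N` built into `Test.regularize`. The zero
extension is harmless because `φ` vanishes off `Q`. -/
theorem pairing_regularize (v : L1 N m) (K : Fin m → Fin N) {n : ℕ} (φ : Test N n)
    (J : Fin n → Fin N) :
    pairing N (component N m K (regularize hε v)) (Test.component N n J φ) =
      pairing N (component N m K v) (Test.component N n J (φ.regularize hε)) := by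
  have hφ : Integrable φ volume := φ.continuous.integrable_of_hasCompactSupport φ.hasCompactSupport
  have hφJ : Integrable (fun x => φ x J) volume :=
    (EuclideanSpace.proj (𝕜 := ℝ) J).integrable_comp hφ
  have hV := integrable_zeroExt_coeFn v
  have hVK : Integrable (fun x => zeroExt v x K) volume :=
    (EuclideanSpace.proj (𝕜 := ℝ) K).integrable_comp hV
  have hW := integrable_dilate hε hV
  have hWK := integrable_dilate hε hVK
  have hmφ : ∀ x, mollify hε (fun y => φ y J) x = mollify hε φ x J :=
    mollify_comp_clm hε (EuclideanSpace.proj (𝕜 := ℝ) J) hφ.locallyIntegrable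
  have hmW : ∀ x, mollify hε (dilate ε fun y => zeroExt v y K) x =
      mollify hε (dilate ε (zeroExt v)) x K :=
    mollify_comp_clm hε (EuclideanSpace.proj (𝕜 := ℝ) K) hW.locallyIntegrable
  have hext : (fun x => zeroExt v x K) = zeroExt fun x => v x K := by
    ext x
    by_cases hx : x ∈ cube N
    · rw [← Subtype.coe_mk x hx, zeroExt_coe, zeroExt_coe]
    · rw [zeroExt_of_notMem _ hx, zeroExt_of_notMem _ hx]
      rfl
  rw [pairing_component, pairing_component]
  calc ∫ x : cube N, regularize hε v x K * Test.component N n J φ x ∂cubeVol N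
      = ∫ x : cube N, (fun y => mollify hε (dilate ε fun y => zeroExt v y K) y * φ y J) x
          ∂cubeVol N := by
        refine integral_congr_ae ?_
        filter_upwards [coeFn_regularize hε v] with x hx
        rw [hx, Test.component_apply, hmW]
    _ = ∫ x, mollify hε (dilate ε fun y => zeroExt v y K) x * φ x J := by
        rw [integral_cubeVol fun y => mollify hε (dilate ε fun y => zeroExt v y K) y * φ y J]
        refine setIntegral_eq_integral_of_forall_compl_eq_zero fun x hx => ?_
        rw [φ.eq_zero_of_notMem hx]
        simp
    _ = ∫ x, dilate ε (fun y => zeroExt v y K) x * mollify hε (fun y => φ y J) x :=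
        integral_mollify_mul hε hWK hφJ
    _ = ∫ x, dilate ε (fun z => zeroExt v z K * mollify hε (fun y => φ y J) ((1 + ε) • z)) x := by
        refine integral_congr_ae (Eventually.of_forall fun x => ?_)
        simp only [dilate]
        rw [smul_inv_smul₀ (by positivity)]
    _ = ∫ x, zeroExt v x K * φ.regularize hε x J := by
        rw [integral_dilate hε, ← integral_smul]
        refine integral_congr_ae (Eventually.of_forall fun x => ?_)
        simp only [hmφ, Test.regularize_apply, PiLp.smul_apply, smul_eq_mul]
        ring
    _ = _ := by
        rw [integral_mul_eq_integral_zeroExt_mul, ← hext]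
        rfl

theorem toDist_regularize (v : L1 N m) (φ : Test N m) :
    toDist (regularize hε v) φ = toDist v (φ.regularize hε) := by
  simp only [toDist_eq_sum, pairing_regularize]

theorem distOp_regularize (B : DiffOp N l) (v : L1 N l) (φ : Test N (l + 1)) :
    distOp B (regularize hε v) φ = (1 + ε)⁻¹ * distOp B v (φ.regularize hε) := by
  have h : (1 + ε) ≠ 0 := by positivity
  simp only [distOp_eq_sum, pairing_regularize, Test.partialDeriv_regularize, map_smul,
    mul_smul_comm, ← Finset.smul_sum]
  rw [mul_neg, smul_eq_mul, inv_mul_cancel_left₀ h]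

theorem regularize_zero : regularize hε (0 : L1 N m) = 0 :=
  toDist_injective fun φ => by rw [toDist_regularize, toDist_zero]

/-! ### Convergence of the regularizations -/

theorem norm_le_of_mem_cube {x : EuclideanSpace ℝ (Fin N)} (hx : x ∈ cube N) : ‖x‖ ≤ N := by
  rw [EuclideanSpace.norm_eq]
  refine Real.sqrt_le_iff.2 ⟨by positivity, ?_⟩
  calc ∑ i, ‖x i‖ ^ 2 ≤ ∑ _i : Fin N, (1 : ℝ) := by
        refine Finset.sum_le_sum fun i _ => ?_
        have := hx i
        rw [Real.norm_eq_abs, sq_abs]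
        nlinarith [this.1, this.2]
    _ = N := by simp
    _ ≤ (N : ℝ) ^ 2 := by
        rcases Nat.eq_zero_or_pos N with rfl | hN
        · simp
        · have : (1 : ℝ) ≤ N := by exact_mod_cast hN
          nlinarith

theorem exists_forall_norm_mollify_dilate_sub_le {F : Type*} [NormedAddCommGroup F]
    [NormedSpace ℝ F] [CompleteSpace F] {g : EuclideanSpace ℝ (Fin N) → F} (hg : Continuous g)
    (hs : HasCompactSupport g) {δ : ℝ} (hδ : 0 < δ) :
    ∃ ε₀ > 0, ∀ ε (hε : 0 < ε), ε ≤ ε₀ → ∀ x ∈ cube N,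
      ‖mollify hε (dilate ε g) x - g x‖ ≤ δ := by
  obtain ⟨η, hη, hgη⟩ := Metric.uniformContinuous_iff.1
    (hs.uniformContinuous_of_continuous hg) (δ / 2) (half_pos hδ)
  -- Mollifying looks at distance less than `ε / 4`, and the dilation moves a point of `Q` by at
  -- most `ε N`; both are below `ε (N + 1) ≤ η`.
  refine ⟨η / (N + 1), by positivity, fun ε hε hεη x hx => ?_⟩
  have hN : (0 : ℝ) < N + 1 := by positivity
  have hεη' : ε * (N + 1) ≤ η := (le_div_iff₀ hN).1 hεη
  have hεle : ε ≤ η := le_trans (le_mul_of_one_le_right hε.le (by simp)) hεη'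
  have hinv : (1 + ε)⁻¹ ≤ 1 := inv_le_one_of_one_le₀ (by linarith)
  have hinv0 : 0 ≤ (1 + ε)⁻¹ := by positivity
  have h1 : dist (mollify hε (dilate ε g) x) (dilate ε g x) ≤ δ / 2 := by
    refine ContDiffBump.dist_normed_convolution_le
      (hg.comp (continuous_const_smul _)).aestronglyMeasurable fun y hy => (hgη ?_).le
    have hy' : dist y x < ε / 4 := hy
    rw [dist_smul₀, Real.norm_of_nonneg hinv0]
    nlinarith [dist_nonneg (x := y) (y := x)]
  have h2 : dist (dilate ε g x) (g x) ≤ δ / 2 := by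
    refine (hgη ?_).le
    have h3 : (1 + ε)⁻¹ • x - x = (-(ε * (1 + ε)⁻¹)) • x := by
      nth_rewrite 2 [← one_smul ℝ x]
      rw [← sub_smul]
      congr 1
      field_simp
      ring
    rw [dist_eq_norm, h3, norm_smul, norm_neg, Real.norm_of_nonneg (by positivity)]
    have h4 := norm_le_of_mem_cube hx
    calc ε * (1 + ε)⁻¹ * ‖x‖ ≤ ε * 1 * N := by gcongr
      _ < ε * (N + 1) := by linarith
      _ ≤ η := hεη'
  rw [← dist_eq_norm]
  calc _ ≤ _ := dist_triangle _ (dilate ε g x) _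
    _ ≤ δ := by linarith

/-- For continuous compactly supported functions the convergence is uniform on `Q`. Density in `L¹`
carries it over, since the regularization has `L¹` norm at most `(1 + ε)^N ≤ 2^N` when `ε ≤ 1`. -/
theorem exists_forall_norm_regularize_sub_le (v : L1 N m) {δ : ℝ} (hδ : 0 < δ) :
    ∃ ε₀ > 0, ∀ ε (hε : 0 < ε), ε ≤ ε₀ → ‖regularize hε v - v‖ ≤ δ := by
  set V := zeroExt v with hVdef
  have hV : Integrable V volume := integrable_zeroExt_coeFn v
  set ν : ℝ := (cubeVol N).real univ
  have hν : 0 ≤ ν := measureReal_nonneg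
  -- The three summands pay for the regularized remainder, the uniform error over `Q`, and the
  -- remainder itself.
  set δ' := δ / (2 ^ N + ν + 1)
  have hδ' : 0 < δ' := by positivity
  obtain ⟨g, hgs, hgV, hgc, hgi⟩ := hV.exists_hasCompactSupport_integral_sub_le hδ'
  obtain ⟨ε₀, hε₀, hconv⟩ := exists_forall_norm_mollify_dilate_sub_le hgc hgs hδ'
  refine ⟨min ε₀ 1, by positivity, fun ε hε hle => ?_⟩
  have hVg : Integrable (fun x => V x - g x) volume := hV.sub hgi
  have hM := integrable_mollify hε (integrable_dilate hε hVg)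
  have hM' : ∫ x, ‖mollify hε (dilate ε fun y => V y - g y) x‖ ≤ 2 ^ N * δ' := by
    calc _ ≤ ∫ x, ‖dilate ε (fun y => V y - g y) x‖ :=
          integral_norm_mollify_le hε (integrable_dilate hε hVg)
      _ = (1 + ε) ^ N * ∫ x, ‖V x - g x‖ := integral_dilate hε fun y => ‖V y - g y‖
      _ ≤ 2 ^ N * δ' := by
          gcongr
          linarith [hle.trans (min_le_right _ _)]
  have hcube : ∀ f : EuclideanSpace ℝ (Fin N) → Tensor N m, Integrable f volume →
      ∫ x : cube N, ‖f x‖ ∂cubeVol N ≤ ∫ x, ‖f x‖ := fun f hf => by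
    rw [integral_cubeVol fun x => ‖f x‖]
    exact setIntegral_le_integral hf.norm (Eventually.of_forall fun x => norm_nonneg _)
  have hpt : ∀ᵐ x : cube N ∂cubeVol N, ‖(regularize hε v - v) x‖ ≤
      ‖mollify hε (dilate ε fun y => V y - g y) x‖ + δ' + ‖V x - g x‖ := by
    filter_upwards [Lp.coeFn_sub (regularize hε v) v, coeFn_regularize hε v] with x h1 h2
    have h3 := mollify_sub hε (integrable_dilate hε hV).locallyIntegrable
      (integrable_dilate hε hgi).locallyIntegrable x
    have h4 : (regularize hε v - v) x = mollify hε (dilate ε fun y => V y - g y) x +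
        (mollify hε (dilate ε g) x - g x) - (V x - g x) := by
      rw [h1, Pi.sub_apply, h2]
      change _ = mollify hε (fun y => dilate ε V y - dilate ε g y) x + _ - _
      rw [h3, hVdef, zeroExt_coe]
      abel
    rw [h4]
    refine (norm_sub_le _ _).trans (add_le_add ((norm_add_le _ _).trans ?_) le_rfl)
    exact add_le_add le_rfl (hconv ε hε (hle.trans (min_le_left _ _)) x x.2)
  have hi1 := (integrable_restrict_cube hM).norm
  have hi2 := (integrable_restrict_cube hVg).norm
  have hi3 : Integrable (fun x : cube N => ‖mollify hε (dilate ε fun y => V y - g y) x‖ + δ')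
      (cubeVol N) := hi1.add (integrable_const δ')
  rw [L1.norm_eq_integral_norm]
  calc _ ≤ ∫ x : cube N, (‖mollify hε (dilate ε fun y => V y - g y) x‖ + δ' + ‖V x - g x‖)
          ∂cubeVol N :=
        integral_mono_ae (L1.integrable_coeFn _).norm
          (hi3.add hi2) hpt
    _ = ∫ x : cube N, ‖mollify hε (dilate ε fun y => V y - g y) x‖ ∂cubeVol N + ν * δ' +
          ∫ x : cube N, ‖V x - g x‖ ∂cubeVol N := by
        rw [integral_add hi3 hi2, integral_add hi1 (integrable_const _),
          integral_const, smul_eq_mul]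
    _ ≤ 2 ^ N * δ' + ν * δ' + δ' :=
        add_le_add (add_le_add ((hcube _ hM).trans hM') le_rfl) ((hcube _ hVg).trans hgV)
    _ = δ := by
        simp only [δ']
        field_simp

end

section

variable {N k l m : ℕ}

/-! ### Recovery sequences -/

/-- The weight of the coefficients of `𝓑` against the components of `v`. -/
def coeffWeight (B : DiffOp N l) (v : L1 N l) : ℝ :=
  ∑ i, ∑ J, ∑ K, ‖B i (J, K)‖ * ‖component N l K v‖

theorem tendsto_coeffWeight_sub {B : ℕ → DiffOp N l} {B' : DiffOp N l}
    (hB : Tendsto B atTop (𝓝 B')) (v : L1 N l) :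
    Tendsto (fun n => coeffWeight (B n - B') v) atTop (𝓝 0) := by
  have h : ∀ i J K, Tendsto (fun n => ‖(B n - B') i (J, K)‖ * ‖component N l K v‖) atTop (𝓝 0) := by
    intro i J K
    have h1 : Tendsto (fun n => B n i (J, K)) atTop (𝓝 (B' i (J, K))) :=
      ((EuclideanSpace.proj (𝕜 := ℝ) (J, K)).continuous.tendsto (B' i)).comp
        (tendsto_pi_nhds.1 hB i)
    have h2 := (tendsto_iff_norm_sub_tendsto_zero.1 h1).mul_const ‖component N l K v‖
    rw [zero_mul] at h2
    exact h2
  have := tendsto_finsetSum Finset.univ fun i _ => tendsto_finsetSum Finset.univ fun J _ =>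
    tendsto_finsetSum Finset.univ fun K _ => h i J K
  simpa [coeffWeight] using this

theorem norm_distOp_le (B : DiffOp N l) (v : L1 N l) (φ : Test N (l + 1)) {D : ℝ} (hD0 : 0 ≤ D)
    (hD : ∀ i x, ‖pderiv i φ x‖ ≤ D) : ‖distOp B v φ‖ ≤ coeffWeight B v * D := by
  rw [distOp_eq_sum, norm_neg, coeffWeight]
  simp only [Finset.sum_mul]
  refine norm_sum_le_of_le _ fun i _ => norm_sum_le_of_le _ fun J _ =>
    norm_sum_le_of_le _ fun K _ => ?_
  rw [norm_mul, mul_assoc]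
  gcongr
  refine (norm_pairing_le _ _).trans ?_
  gcongr
  refine (BoundedContinuousFunction.norm_le hD0).2 fun x => ?_
  rw [Test.component_apply, Test.partialDeriv_apply]
  exact (PiLp.norm_apply_le _ _).trans (hD i x)

/-- Any first order operator maps a regularized `L¹` function to a bounded measure. -/
theorem exists_mass_distOp_regularize_le {ε : ℝ} (hε : 0 < ε) (N l : ℕ) :
    ∃ K : ℝ, ∀ (B : DiffOp N l) (v : L1 N l),
      mass (distOp B (regularize hε v)) ≤ ENNReal.ofReal (coeffWeight B v * K) := by
  obtain ⟨K, hK0, hK⟩ := Test.exists_norm_pderiv_regularize_le hε N (l + 1)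
  refine ⟨K, fun B v => mass_le_of_forall_enorm_le (isLinearMap_distOp _ _) fun φ => ?_⟩
  have hw : 0 ≤ coeffWeight B v := Finset.sum_nonneg fun i _ => Finset.sum_nonneg fun J _ =>
    Finset.sum_nonneg fun K _ => by positivity
  have h : ‖distOp B (regularize hε v) φ‖ ≤ coeffWeight B v * K * ‖φ.toC0‖ := by
    rw [distOp_regularize, norm_mul, Real.norm_of_nonneg (by positivity), mul_assoc]
    have h1 : (1 + ε)⁻¹ ≤ 1 := inv_le_one_of_one_le₀ (by linarith)
    exact (mul_le_of_le_one_left (norm_nonneg _) h1).trans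
      (norm_distOp_le B v _ (by positivity) (hK φ))
  simp only [← ofReal_norm]
  rw [← ENNReal.ofReal_mul (by positivity)]
  exact ENNReal.ofReal_le_ofReal h

/-- The dilation scales `𝓑 v` by `(1 + ε)⁻¹` but not `w`. The mismatch is `1 - (1 + ε)⁻¹ ≤ ε` times
`w`, and the rest is the old residual tested with a function whose norm grew by at most `(1 + ε)^N`.
-/
theorem mass_toDist_sub_distOp_regularize_le {ε : ℝ} (hε : 0 < ε) (B : DiffOp N l) (v : L1 N l)
    (w : L1 N (l + 1)) :
    mass (fun φ => toDist (regularize hε w) φ - distOp B (regularize hε v) φ) ≤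
      ENNReal.ofReal ((1 + ε) ^ N) *
        (mass (fun φ => toDist w φ - distOp B v φ) + ENNReal.ofReal ε * ‖w‖ₑ) := by
  have hlin := isLinearMap_sub (isLinearMap_toDist w) (isLinearMap_distOp B v)
  refine mass_le_of_forall_enorm_le
    (isLinearMap_sub (isLinearMap_toDist _) (isLinearMap_distOp _ _)) fun φ => ?_
  have hinv : (1 + ε)⁻¹ ≤ 1 := inv_le_one_of_one_le₀ (by linarith)
  have hinv' : 1 - (1 + ε)⁻¹ ≤ ε := by
    have : 1 - (1 + ε)⁻¹ = ε * (1 + ε)⁻¹ := by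
      field_simp
      ring
    rw [this]
    exact mul_le_of_le_one_right hε.le hinv
  have e : toDist (regularize hε w) φ - distOp B (regularize hε v) φ =
      (1 + ε)⁻¹ * (toDist w (φ.regularize hε) - distOp B v (φ.regularize hε)) +
        (1 - (1 + ε)⁻¹) * toDist w (φ.regularize hε) := by
    rw [toDist_regularize, distOp_regularize]
    ring
  have hA : ‖(φ.regularize hε).toC0‖ₑ ≤ ENNReal.ofReal ((1 + ε) ^ N) * ‖φ.toC0‖ₑ := by
    rw [← ofReal_norm, ← ofReal_norm, ← ENNReal.ofReal_mul (by positivity)]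
    exact ENNReal.ofReal_le_ofReal (φ.norm_toC0_regularize_le hε)
  have h1 : ‖(1 + ε)⁻¹‖ₑ ≤ 1 := by
    rw [← ofReal_norm, Real.norm_of_nonneg (by positivity)]
    simpa using hinv
  have h2 : ‖1 - (1 + ε)⁻¹‖ₑ ≤ ENNReal.ofReal ε := by
    rw [← ofReal_norm, Real.norm_of_nonneg (by linarith)]
    exact ENNReal.ofReal_le_ofReal hinv'
  rw [e]
  refine (enorm_add_le _ _).trans ?_
  rw [enorm_mul, enorm_mul]
  calc _ ≤ 1 * (mass (fun φ => toDist w φ - distOp B v φ) * ‖(φ.regularize hε).toC0‖ₑ) +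
        ENNReal.ofReal ε * (‖w‖ₑ * ‖(φ.regularize hε).toC0‖ₑ) := by
        gcongr
        · exact enorm_le_mass_mul hlin _
        · exact (enorm_le_mass_mul (isLinearMap_toDist w) _).trans
            (by gcongr; exact mass_toDist_le w)
    _ = (mass (fun φ => toDist w φ - distOp B v φ) + ENNReal.ofReal ε * ‖w‖ₑ) *
          ‖(φ.regularize hε).toC0‖ₑ := by ring
    _ ≤ (mass (fun φ => toDist w φ - distOp B v φ) + ENNReal.ofReal ε * ‖w‖ₑ) *
          (ENNReal.ofReal ((1 + ε) ^ N) * ‖φ.toC0‖ₑ) := by gcongr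
    _ = _ := by ring

theorem distOp_sub_apply (A B : DiffOp N l) (v : L1 N l) (φ : Test N (l + 1)) :
    distOp (A - B) v φ = distOp A v φ - distOp B v φ := by
  simp only [distOp_eq_sum, Pi.sub_apply, PiLp.sub_apply, sub_mul, Finset.sum_sub_distrib]
  ring

theorem extend_regularize {ε : ℝ} (hε : 0 < ε) (v : (l : Fin k) → L1 N (l + 1)) (l : ℕ) :
    extend (fun i => regularize hε (v i)) l = regularize hε (extend v l) := by
  unfold extend
  split_ifs
  · rfl
  · exact (regularize_zero hε).symm

theorem mass_gradResidual_regularize_le {ε : ℝ} (hε : 0 < ε) (u : L1R N)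
    (v : (l : Fin k) → L1 N (l + 1)) :
    mass (gradResidual u fun i => regularize hε (v i)) ≤
      mass (gradResidual u v) + ‖regularize hε (extend v 0) - extend v 0‖ₑ := by
  have h : gradResidual u (fun i => regularize hε (v i)) = fun φ =>
      gradResidual u v φ - toDist (regularize hε (extend v 0) - extend v 0) φ := by
    ext φ
    rw [gradResidual, gradResidual, extend_regularize, toDist_sub]
    ring
  rw [h]
  exact (mass_sub_le (isLinearMap_gradResidual u v) (isLinearMap_toDist _)).trans
    (add_le_add le_rfl (mass_toDist_le _))

/-- The bound for the value of the functional at regularized auxiliary fields. -/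
def regularizedBound {ε : ℝ} (hε : 0 < ε) (α : Fin (k + 1) → ℝ)
    (B : (l : Fin k) → DiffOp N (l + 1)) (u : L1R N) (v : (l : Fin k) → L1 N (l + 1))
    (e : Fin k → ℝ) : ℝ≥0∞ :=
  ENNReal.ofReal (α 0) *
      (mass (gradResidual u v) + ‖regularize hε (extend v 0) - extend v 0‖ₑ) +
    ∑ l : Fin k, ENNReal.ofReal (α l.succ) * (ENNReal.ofReal ((1 + ε) ^ N) *
      (mass (opResidual B v l) + ENNReal.ofReal ε * ‖extend v (l + 1)‖ₑ) + ENNReal.ofReal (e l))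

/-- The regularized fields compete for every tuple `B`, whatever `B' l` did to `v l`. As `K` is
chosen before `α` and `B`, one may let `B → B'` at fixed `ε`. -/
theorem exists_pgv_le_regularizedBound {ε : ℝ} (hε : 0 < ε) (B' : (l : Fin k) → DiffOp N (l + 1))
    (u : L1R N) (v : (l : Fin k) → L1 N (l + 1)) :
    ∃ K : Fin k → ℝ, ∀ (α : Fin (k + 1) → ℝ) (B : (l : Fin k) → DiffOp N (l + 1)),
      pgv α B u ≤ regularizedBound hε α B' u v fun l => coeffWeight (B l - B' l) (v l) * K l := by
  choose K hK using fun l : Fin k => exists_mass_distOp_regularize_le hε N (l + 1)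
  refine ⟨K, fun α B => ?_⟩
  refine (pgv_le_pgvValue (v := fun i => regularize hε (v i)) fun l =>
    mass_lt_top_iff.1 ((hK l (B l) (v l)).trans_lt ENNReal.ofReal_lt_top)).trans ?_
  refine add_le_add (by gcongr; exact mass_gradResidual_regularize_le hε u v)
    (Finset.sum_le_sum fun l _ => ?_)
  gcongr
  -- Splitting `B l = B' l + (B l - B' l)`: the first part is the residual of the limit operator,
  -- the second is small with the coefficients.
  have h : opResidual B (fun i => regularize hε (v i)) l = fun φ =>
      (toDist (regularize hε (extend v (l + 1))) φ - distOp (B' l) (regularize hε (v l)) φ) -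
        distOp (B l - B' l) (regularize hε (v l)) φ := by
    ext φ
    rw [opResidual, extend_regularize, distOp_sub_apply]
    ring
  rw [h]
  refine (mass_sub_le (isLinearMap_sub (isLinearMap_toDist _) (isLinearMap_distOp _ _))
    (isLinearMap_distOp _ _)).trans (add_le_add ?_ (hK l _ _))
  exact mass_toDist_sub_distOp_regularize_le hε (B' l) (v l) (extend v (l + 1))

theorem tendsto_regularize (v : L1 N m) :
    Tendsto (fun j : ℕ => regularize (Nat.one_div_pos_of_nat (α := ℝ) (n := j)) v) atTop (𝓝 v) := by
  rw [Metric.tendsto_atTop]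
  intro δ hδ
  obtain ⟨ε₀, hε₀, h⟩ := exists_forall_norm_regularize_sub_le v (half_pos hδ)
  obtain ⟨j₀, hj₀⟩ := (tendsto_order.1 (tendsto_one_div_add_atTop_nhds_zero_nat (𝕜 := ℝ))).2 _ hε₀
    |> eventually_atTop.1
  refine ⟨j₀, fun j hj => ?_⟩
  rw [dist_eq_norm]
  exact (h _ _ (hj₀ j hj).le).trans_lt (half_lt_self hδ)

theorem tendsto_regularizedBound {α : Fin (k + 1) → ℝ} {B : (l : Fin k) → DiffOp N (l + 1)}
    (u : L1R N) (v : (l : Fin k) → L1 N (l + 1)) :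
    Tendsto (fun j : ℕ =>
      regularizedBound (Nat.one_div_pos_of_nat (α := ℝ) (n := j)) α B u v fun _ => 0) atTop
      (𝓝 (pgvValue α B u v)) := by
  have h1 : Tendsto (fun j : ℕ => ‖regularize (Nat.one_div_pos_of_nat (α := ℝ) (n := j))
      (extend v 0) - extend v 0‖ₑ) atTop (𝓝 0) := by
    simpa using ((tendsto_regularize (extend v 0)).sub_const (extend v 0)).enorm
  have h2 : Tendsto (fun j : ℕ => ENNReal.ofReal ((1 + 1 / ((j : ℝ) + 1)) ^ N)) atTop (𝓝 1) := by
    have := ENNReal.tendsto_ofReal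
      (((tendsto_one_div_add_atTop_nhds_zero_nat (𝕜 := ℝ)).const_add 1).pow N)
    simpa using this
  have h3 : Tendsto (fun j : ℕ => ENNReal.ofReal (1 / ((j : ℝ) + 1))) atTop (𝓝 0) := by
    simpa using ENNReal.tendsto_ofReal (tendsto_one_div_add_atTop_nhds_zero_nat (𝕜 := ℝ))
  refine Tendsto.add ?_ (tendsto_finsetSum _ fun l _ => ?_)
  · refine ENNReal.Tendsto.const_mul ?_ (Or.inr ENNReal.ofReal_ne_top)
    simpa using tendsto_const_nhds.add h1
  · refine ENNReal.Tendsto.const_mul ?_ (Or.inr ENNReal.ofReal_ne_top)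
    have h4 := (ENNReal.Tendsto.mul_const (b := ‖extend v (l + 1)‖ₑ) h3
      (Or.inr (by simp))).const_add (mass (opResidual B v l))
    rw [zero_mul, add_zero] at h4
    have h5 := ENNReal.Tendsto.mul h2 (Or.inl one_ne_zero) h4 (Or.inr ENNReal.one_ne_top)
    simpa using h5

theorem limsup_energy_le {B : ℕ → (l : Fin k) → DiffOp N (l + 1)}
    {B' : (l : Fin k) → DiffOp N (l + 1)} (hB : ∀ l, Tendsto (fun n => B n l) atTop (𝓝 (B' l)))
    {α : ℕ → Fin (k + 1) → ℝ} {α' : Fin (k + 1) → ℝ} (hα' : ∀ i, 0 < α' i)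
    (hαlim : Tendsto α atTop (𝓝 α')) (uη : L2R N) (u : L1R N) :
    limsup (fun n => energy uη (α n) (B n) u) atTop ≤ energy uη α' B' u := by
  by_cases hu : u ∈ BV N
  swap
  · rw [energy, if_neg hu]
    exact le_top
  simp only [energy_of_mem uη _ _ hu]
  rw [pgv, ENNReal.add_iInf]
  refine le_iInf fun v => ?_
  by_cases hv : ∀ l, v l ∈ BVOp (B' l)
  swap
  · rw [iInf_neg hv, add_top]
    exact le_top
  rw [iInf_pos hv]
  -- The limit `ε → 0` comes last: it suffices to bound the limsup in `n` for each fixed `ε = 1 / (j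
  -- + 1)`.
  refine ge_of_tendsto' ((tendsto_regularizedBound u v).const_add (fidelity uη u ^ 2)) fun j => ?_
  have hε : 0 < 1 / ((j : ℝ) + 1) := Nat.one_div_pos_of_nat
  obtain ⟨K, hK⟩ := exists_pgv_le_regularizedBound hε B' u v
  have hαi : ∀ i, Tendsto (fun n => ENNReal.ofReal (α n i)) atTop (𝓝 (ENNReal.ofReal (α' i))) :=
    fun i => ENNReal.tendsto_ofReal (tendsto_pi_nhds.1 hαlim i)
  have hα0 : ∀ i, ENNReal.ofReal (α' i) ≠ 0 := fun i => (ENNReal.ofReal_pos.2 (hα' i)).ne'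
  have hlim : Tendsto (fun n => regularizedBound hε (α n) B' u v fun l =>
      coeffWeight (B n l - B' l) (v l) * K l) atTop
      (𝓝 (regularizedBound hε α' B' u v fun _ => 0)) := by
    refine Tendsto.add ?_ (tendsto_finsetSum _ fun l _ => ?_)
    · exact ENNReal.Tendsto.mul_const (hαi 0) (Or.inl (hα0 0))
    · refine ENNReal.Tendsto.mul (hαi l.succ) (Or.inl (hα0 _)) (Tendsto.const_add _ ?_)
        (Or.inr ENNReal.ofReal_ne_top)
      have := (tendsto_coeffWeight_sub (hB l) (v l)).mul_const (K l)
      rw [zero_mul] at this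
      exact ENNReal.tendsto_ofReal this
  rw [← (hlim.const_add (fidelity uη u ^ 2)).limsup_eq]
  exact limsup_le_limsup (Eventually.of_forall fun n => add_le_add le_rfl (hK (α n) (B n)))

end

end PGV

end
-- Compactness and Γ-convergence; constant sequences are recovery sequences.
theorem theorem4p2 (N k : ℕ) (hN : 1 ≤ N) (hk : 1 ≤ k) (uη : PGV.L2R N)
    (B : ℕ → (l : Fin k) → PGV.DiffOp N (l + 1)) (B' : (l : Fin k) → PGV.DiffOp N (l + 1))
    (α : ℕ → Fin (k + 1) → ℝ) (α' : Fin (k + 1) → ℝ)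
    (hB : ∀ n (l : Fin k), B n l ∈ PGV.PiClass N (l + 1))
    (hBcpt : ∀ l : Fin k, PGV.CompactClosed (Set.range fun n => B n l))
    (hBlim : ∀ l : Fin k, Tendsto (fun n => PGV.opNorm (B n l - B' l)) atTop (𝓝 0))
    (hα : ∀ n i, 0 < α n i) (hα' : ∀ i, 0 < α' i) (hαlim : Tendsto α atTop (𝓝 α')) :
    -- compactness
    (∀ u : ℕ → PGV.L1R N, (∀ n, u n ∈ PGV.BV N) →
      (⨆ n, PGV.energy uη (α n) (B n) (u n)) < ⊤ →
      ∃ u' ∈ PGV.BV N, ∃ s : ℕ → ℕ, StrictMono s ∧ PGV.BVWeakStar (fun j => u (s j)) u') ∧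
    -- `Γ`-convergence in `L¹(Q)`
    PGV.GammaConverges (fun n => PGV.energy uη (α n) (B n)) (PGV.energy uη α' B') ∧
    -- on `BV(Q)`, recovery sequences can be taken in `BV(Q)`
    (∀ u ∈ PGV.BV N, ∃ w : ℕ → PGV.L1R N, (∀ n, w n ∈ PGV.BV N) ∧ Tendsto w atTop (𝓝 u) ∧
      limsup (fun n => PGV.energy uη (α n) (B n) (w n)) atTop ≤ PGV.energy uη α' B' u) := by
  have hfam : PGV.ConvergentFamily B B' :=
    ⟨fun n l => (hB n l).1, hBcpt, fun l => PGV.tendsto_of_opNorm_sub (hBlim l)⟩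
  have hlimsup : ∀ u : PGV.L1R N,
      limsup (fun n => PGV.energy uη (α n) (B n) u) atTop ≤ PGV.energy uη α' B' u :=
    PGV.limsup_energy_le hfam.tendsto hα' hαlim uη
  exact ⟨fun u _ hen => hfam.exists_bvWeakStar hk hN hα hα' hαlim uη hen,
    ⟨fun u w hw => hfam.energy_le_liminf hα hα' hαlim uη hw,
      fun u => ⟨fun _ => u, tendsto_const_nhds, hlimsup u⟩⟩,
    fun u hu => ⟨fun _ => u, fun _ => hu, tendsto_const_nhds, hlimsup u⟩⟩
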